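/- Let $d\ge 1$, $I_\pm=\{\pm1,\dots,\pm d\}$, $r(\tau)=\mathrm{sign}(\tau)e_{|\tau|}\in\mathbb Z^d$, $|x|=\max_i|x_i|$ on $\mathbb Z^d$, and let $\mathcal H=\mathbb C^{2d}\otimes\ell^2(\mathbb Z^d)$ have the orthonormal basis $|\tau,x\rangle$, $\tau\in I_\pm$, $x\in\mathbb Z^d$; the rows and columns of matrices in $U(2d)$ are indexed by $I_\pm$. Let $\mu$ be a probability measure on $\mathbb T=\mathbb R/2\pi\mathbb Z$ with $d\mu(\theta)=l(\theta)\,d\theta$, $0\le l\in L^\infty(\mathbb T)$, let $\omega=(\omega_y^\tau)_{y\in\mathbb Z^d,\tau\in I_\pm}$ be i.i.d. with law $\mu$, and let $\mathbb D(\omega)|\tau,y\rangle=e^{i\omega_y^\tau}|\tau,y\rangle$. Let $\pi$ be a permutation of $I_\pm$ such that $\sum_{\tau\in\gamma} r(\tau)=0$ for every cycle $\gamma$ of $\pi$ (fixed points counting as cycles of length one), and let $C_\pi$ be its permutation matrix, $C_\pi|\tau\rangle=|\pi(\tau)\rangle$. For $x\in\mathbb Z^d$ let $\mathcal H_x$ be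 the span of the vectors $\bigl|\pi^t(\tau),\,x+\sum_{k=0}^{t}r(\pi^k(\tau))\bigr\rangle$, where $\tau\in I_\pm$ and $0\le t<m_\tau$, with $m_\tau$ the length of the cycle of $\tau$. For an integer $L\ge 1$ let $\mathcal H^{\Lambda_L}=\sum_{|x|\le L}\mathcal H_x$. For $C\in U(2d)$ let $$U^L_\omega(C)=\mathbb D(\omega)\sum_{y\in\mathbb Z^d,\,\tau\in I_\pm}|\tau\rangle\langle\tau|\,C_y\otimes|y+r(\tau)\rangle\langle y|,\qquad C_y=\begin{cases}C_\pi&\text{if }|y|\in\{L-1,L,L+1\},\\ C&\text{otherwise.}\end{cases}$$ The operator $U^L_\omega(C)$ leaves $\mathcal H^{\Lambda_L}$ invariant; let $U^{\Lambda_L}_\omega(C)$ be its restriction to $\mathcal H^{\Lambda_L}$ and, for $z\in\mathbb C$ with $|z|\ne1$, let $R^{\Lambda_L}_\omega(C,z)=(U^{\Lambda_L}_\omega(C)-z)^{-1}$, an operator on $\mathcal H^{\Lambda_L}$. **Proposition.** For all $s\in(0,1)$, $a\ge0$ and $p>1/(1-s)$ there is a constant $c>0$ (depending only on $d,\mu,\pi,s,a,p$)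 such that, for all integers $L\ge1$, all $C\in U(2d)$ with $\|C-C_\pi\|\le L^{-(2(ap+d)+a/s)}$ (operator norm on $\mathbb C^{2d}$), and all $z\in\mathbb C$ with $|z|\neq1$: the operator $U^{\Lambda_L}_\omega(C)-z$ is invertible for every $\omega$, and for all $|\tau,x\rangle,|\sigma,y\rangle\in\mathcal H^{\Lambda_L}$ with $|x-y|>2$ the random variable $|\langle\tau,x|R^{\Lambda_L}_\omega(C,z)|\sigma,y\rangle|^s$ is integrable, with $$\mathbb E_\omega\bigl(|\langle\tau,x|R^{\Lambda_L}_\omega(C,z)|\sigma,y\rangle|^s\bigr)\le\frac{c}{L^{a}}.$$ -/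

import Mathlib

namespace RandomQuantumWalk

noncomputable section

/-- The label set `I_± = {+1,-1,…,+d,-d}`: the pair `(j, ε)` stands for the signed label
`ε (j+1)`. -/
abbrev Dir (d : ℕ) : Type := Fin d × ℤˣ

/-- The lattice `ℤ^d`. -/
abbrev Site (d : ℕ) : Type := Fin d → ℤ

/-- `r(τ) = sign(τ) e_{|τ|}`. -/
def r {d : ℕ} (τ : Dir d) : Site d := Pi.single τ.1 (τ.2 : ℤ)

/-- The norm `|x| = max_i |x_i|` on `ℤ^d`. -/
def boxNorm {d : ℕ} (x : Site d) : ℕ := Finset.univ.sup fun i => (x i).natAbs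

/-- `ℋ = ℂ^{2d} ⊗ ℓ²(ℤ^d)`, realised as `ℓ²(I_± × ℤ^d)`. -/
abbrev Hilb (d : ℕ) : Type := lp (fun _ : Dir d × Site d => ℂ) 2

/-- The basis vector `|τ, x⟩`. -/
def ket {d : ℕ} (τ : Dir d) (x : Site d) : Hilb d := lp.single 2 (τ, x) (1 : ℂ)

/-- `U(2d)`, with rows and columns indexed by `I_±`. -/
abbrev Coin (d : ℕ) : Type := Matrix.unitaryGroup (Dir d) ℂ

/-- The norm of a matrix as an operator on the Euclidean space `ℂ^{2d}`. -/
def opNorm {d : ℕ} (A : Matrix (Dir d) (Dir d) ℂ) : ℝ := ‖Matrix.toEuclideanCLM (𝕜 := ℂ) A‖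

/-! ### The deterministic walk with site dependent coins and the random phases -/

/-- The coordinates of `𝕊(𝒞)ψ`, where
`𝕊(𝒞) = ∑_{y, τ} P_τ C_y ⊗ |y + r(τ)⟩⟨y|`. -/
def walkFun {d : ℕ} (C : Site d → Coin d) (ψ : Dir d × Site d → ℂ) : Dir d × Site d → ℂ :=
  fun i => ∑ σ, (C (i.2 - r i.1) : Matrix (Dir d) (Dir d) ℂ) i.1 σ * ψ (σ, i.2 - r i.1)

theorem memℓp_walkFun {d : ℕ} (C : Site d → Coin d) (ψ : Hilb d) :
    Memℓp (E := fun _ : Dir d × Site d => ℂ) (walkFun C ψ) 2 := by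
  have h2 : (0 : ℝ) < (2 : ENNReal).toReal := by norm_num
  have hψ : Summable fun i : Dir d × Site d => ‖ψ i‖ ^ (2 : ENNReal).toReal :=
    (memℓp_gen_iff h2).1 (lp.memℓp ψ)
  have key : ∀ σ : Dir d, Memℓp (E := fun _ : Dir d × Site d => ℂ)
      (fun i => (C (i.2 - r i.1) : Matrix (Dir d) (Dir d) ℂ) i.1 σ * ψ (σ, i.2 - r i.1)) 2 := by
    intro σ
    apply memℓp_gen
    have hs : Summable fun i : Dir d × Site d =>
        ‖ψ (σ, i.2 - r i.1)‖ ^ (2 : ENNReal).toReal := by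
      rw [← (Equiv.prodComm (Site d) (Dir d)).summable_iff]
      have h0 : ∀ τ : Dir d, Summable fun x : Site d =>
          ‖ψ (σ, x - r τ)‖ ^ (2 : ENNReal).toReal := by
        intro τ
        refine hψ.comp_injective (i := fun x : Site d => (σ, x - r τ)) ?_
        intro x y hxy
        simpa using hxy
      have h1 : Summable fun i : Dir d × Site d =>
          ‖ψ (σ, i.2 - r i.1)‖ ^ (2 : ENNReal).toReal := by
        rw [summable_prod_of_nonneg (fun i => by positivity)]
        exact ⟨h0, Summable.of_finite⟩
      exact (Equiv.prodComm (Site d) (Dir d)).summable_iff.2 h1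
    refine Summable.of_nonneg_of_le (fun i => by positivity) (fun i => ?_) hs
    refine Real.rpow_le_rpow (norm_nonneg _) ?_ h2.le
    rw [norm_mul]
    exact mul_le_of_le_one_left (norm_nonneg _)
      (entry_norm_bound_of_unitary (C (i.2 - r i.1)).2 _ _)
  exact Memℓp.finsetSum Finset.univ fun σ _ => key σ

/-- The operator `𝕊(𝒞)` on `ℋ`. -/
def walk {d : ℕ} (C : Site d → Coin d) : Hilb d →ₗ[ℂ] Hilb d where
  toFun ψ := ⟨walkFun C ψ, memℓp_walkFun C ψ⟩
  map_add' ψ φ := by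
    ext i
    change walkFun C (ψ + φ : Hilb d) i = walkFun C ψ i + walkFun C φ i
    simp [walkFun, mul_add, Finset.sum_add_distrib]
  map_smul' c ψ := by
    ext i
    change walkFun C (c • ψ : Hilb d) i = c * walkFun C ψ i
    simp [walkFun, Finset.mul_sum, mul_left_comm]

/-- The torus `𝕋 = ℝ / 2πℤ`. -/
abbrev Torus : Type := AddCircle (2 * Real.pi)

instance instFactTwoPiPos : Fact (0 < 2 * Real.pi) := ⟨Real.two_pi_pos⟩

/-- The space `𝕋^{I_± × ℤ^d}` of phase configurations. -/
abbrev Phases (d : ℕ) : Type := Dir d × Site d → Torus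

/-- The phase factor `e^{iθ}`. -/
def phase (θ : Torus) : ℂ := (AddCircle.toCircle θ : ℂ)

theorem norm_phase (θ : Torus) : ‖phase θ‖ = 1 :=
  Circle.norm_coe _

theorem memℓp_diag {d : ℕ} (ω : Phases d) (ψ : Hilb d) :
    Memℓp (E := fun _ : Dir d × Site d => ℂ) (fun i => phase (ω i) * ψ i) 2 := by
  have h := lp.memℓp ψ
  rw [memℓp_gen_iff (by norm_num)] at h ⊢
  simpa [norm_phase] using h

/-- The diagonal operator `𝔻(ω) |τ, y⟩ = e^{i ω_y^τ} |τ, y⟩`. -/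
def diag {d : ℕ} (ω : Phases d) : Hilb d →ₗ[ℂ] Hilb d where
  toFun ψ := ⟨fun i => phase (ω i) * ψ i, memℓp_diag ω ψ⟩
  map_add' ψ φ := by
    ext i
    change phase (ω i) * (ψ + φ : Hilb d) i = phase (ω i) * ψ i + phase (ω i) * φ i
    simp [mul_add]
  map_smul' c ψ := by
    ext i
    change phase (ω i) * (c • ψ : Hilb d) i = c * (phase (ω i) * ψ i)
    simp [mul_left_comm]

theorem walk_ket {d : ℕ} (C : Site d → Coin d) (σ : Dir d) (y : Site d) :
    walk C (ket σ y) =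
      ∑ τ, (C y : Matrix (Dir d) (Dir d) ℂ) τ σ • ket τ (y + r τ) := by
  ext ⟨τ, x⟩
  have hL : (walk C (ket σ y)) (τ, x) =
      if x - r τ = y then (C y : Matrix (Dir d) (Dir d) ℂ) τ σ else 0 := by
    change walkFun C (ket σ y) (τ, x) = _
    simp only [walkFun, ket, lp.single_apply, Pi.single_apply, Prod.mk.injEq]
    split_ifs with h
    · simp [h]
    · simp [h]
  rw [hL, lp.coeFn_sum, Finset.sum_apply]
  simp only [lp.coeFn_smul, Pi.smul_apply, ket, lp.single_apply, Pi.single_apply, Prod.mk.injEq,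
    smul_eq_mul, mul_ite, mul_one, mul_zero]
  rw [Finset.sum_eq_single τ (fun ρ _ hρ => by simp [hρ.symm]) (by simp)]
  simp [sub_eq_iff_eq_add]

theorem diag_ket {d : ℕ} (ω : Phases d) (τ : Dir d) (y : Site d) :
    diag ω (ket τ y) = phase (ω (τ, y)) • ket τ y := by
  ext i
  change phase (ω i) * (ket τ y) i = _
  by_cases h : i = (τ, y)
  · subst h; simp
  · simp [ket, lp.single_apply, h]

/-! ### Permutation coins and the invariant subspaces -/

/-- The permutation matrix `C_π |τ⟩ = |π(τ)⟩`. -/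
def permCoin {d : ℕ} (π : Equiv.Perm (Dir d)) : Coin d :=
  ⟨Matrix.of fun ρ τ => if ρ = π τ then 1 else 0, by
    rw [Matrix.mem_unitaryGroup_iff']
    ext τ τ'
    simp [Matrix.mul_apply, Matrix.one_apply, Matrix.star_apply, eq_comm]⟩

/-- The condition `∑_{s=0}^{m_j-1} r(π_j^s(τ_j)) = 0` for every cycle `π_j` of `π` (a fixed point
being a cycle of length one). -/
def NoDrift {d : ℕ} (π : Equiv.Perm (Dir d)) : Prop :=
  ∀ τ : Dir d, ∑ s ∈ Finset.range (Function.minimalPeriod π τ), r ((π ^ s) τ) = 0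

/-- The vector `|π^t(τ), x + ∑_{s=0}^t r(π^s(τ))⟩`. -/
def cycleKet {d : ℕ} (π : Equiv.Perm (Dir d)) (τ : Dir d) (x : Site d) (t : ℕ) : Hilb d :=
  ket ((π ^ t) τ) (x + ∑ s ∈ Finset.range (t + 1), r ((π ^ s) τ))

/-- `ℋ_x^τ = span {|π^t(τ), x + ∑_{s=0}^t r(π^s(τ))⟩ : t = 0, …, m-1}`, where `m` is the length of
the cycle of `τ`. -/
def cycleSpace {d : ℕ} (π : Equiv.Perm (Dir d)) (τ : Dir d) (x : Site d) :
    Submodule ℂ (Hilb d) :=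
  Submodule.span ℂ (cycleKet π τ x '' Set.Iio (Function.minimalPeriod π τ))

/-- `ℋ_x`, the sum of the `ℋ_x^τ` over all `τ ∈ I_±`. -/
def siteSpace {d : ℕ} (π : Equiv.Perm (Dir d)) (x : Site d) : Submodule ℂ (Hilb d) :=
  ⨆ τ : Dir d, cycleSpace π τ x

/-- `ℋ^{Λ_L}`, the sum of the `ℋ_x` over `|x| ≤ L`. -/
def boxSpace {d : ℕ} (π : Equiv.Perm (Dir d)) (L : ℕ) : Submodule ℂ (Hilb d) :=
  ⨆ x : Site d, ⨆ _ : boxNorm x ≤ L, siteSpace π x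

/-! ### The finite volume restriction -/

/-- The coins of `𝕊^L`: `C_π` where `|x| ∈ {L-1, L, L+1}`, and `C` elsewhere. -/
def boxCoins {d : ℕ} (π : Equiv.Perm (Dir d)) (C : Coin d) (L : ℕ) (x : Site d) : Coin d :=
  if boxNorm x + 1 = L ∨ boxNorm x = L ∨ boxNorm x = L + 1 then permCoin π else C

/-- `U^L_ω(C) = 𝔻(ω) 𝕊^L`. -/
def decoupledWalk {d : ℕ} (π : Equiv.Perm (Dir d)) (C : Coin d) (L : ℕ) (ω : Phases d) :
    Hilb d →ₗ[ℂ] Hilb d :=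
  diag ω ∘ₗ walk (boxCoins π C L)

theorem walk_permCoin_ket {d : ℕ} (π : Equiv.Perm (Dir d)) (C : Site d → Coin d) (σ : Dir d)
    (y : Site d) (h : C y = permCoin π) : walk C (ket σ y) = ket (π σ) (y + r (π σ)) := by
  rw [walk_ket, h]
  simp [permCoin]

theorem cycleKet_mem {d : ℕ} {π : Equiv.Perm (Dir d)} {L : ℕ} {x : Site d} (hx : boxNorm x ≤ L)
    (τ : Dir d) {t : ℕ} (ht : t < Function.minimalPeriod π τ) :
    cycleKet π τ x t ∈ boxSpace π L := by
  have h1 : cycleKet π τ x t ∈ cycleSpace π τ x := Submodule.subset_span ⟨t, ht, rfl⟩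
  have h2 : cycleKet π τ x t ∈ siteSpace π x :=
    (le_iSup (fun τ => cycleSpace π τ x) τ) h1
  exact (le_iSup₂ (f := fun (x : Site d) (_ : boxNorm x ≤ L) => siteSpace π x) x hx) h2

theorem minimalPeriod_pos {d : ℕ} (π : Equiv.Perm (Dir d)) (τ : Dir d) :
    0 < Function.minimalPeriod π τ :=
  Function.minimalPeriod_pos_of_mem_periodicPts
    (Function.Injective.mem_periodicPts π.injective τ)

theorem pow_minimalPeriod {d : ℕ} (π : Equiv.Perm (Dir d)) (τ : Dir d) :
    (π ^ Function.minimalPeriod π τ) τ = τ := by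
  rw [Equiv.Perm.coe_pow]
  exact Function.iterate_minimalPeriod

theorem natAbs_sum_r_le {d : ℕ} (A : Finset (Dir d)) (i : Fin d) :
    ((∑ τ ∈ A, r τ) i).natAbs ≤ 1 := by
  have h : (∑ τ ∈ A, r τ) i =
      (if (i, (1 : ℤˣ)) ∈ A then 1 else 0) - (if (i, (-1 : ℤˣ)) ∈ A then 1 else 0) := by
    have h1 : (∑ τ ∈ A, r τ) i = ∑ τ : Dir d, if τ ∈ A then r τ i else 0 := by
      rw [Finset.sum_apply, Finset.sum_ite_mem, Finset.univ_inter]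
    have hU : (Finset.univ : Finset ℤˣ) = {1, -1} := rfl
    have h2 : ∀ j, j ≠ i → ∑ ε : ℤˣ, (if (j, ε) ∈ A then r (j, ε) i else 0) = 0 := by
      intro j hj
      refine Finset.sum_eq_zero fun ε _ => ?_
      simp [r, hj.symm]
    rw [h1, Fintype.sum_prod_type, Finset.sum_eq_single i (fun j _ hj => h2 j hj) (by simp), hU,
      Finset.sum_pair (by decide)]
    simp only [r, Pi.single_eq_same, Units.val_one, Units.val_neg]
    split_ifs <;> simp
  rw [h]
  split_ifs <;> simp

theorem boxNorm_path_le {d : ℕ} (π : Equiv.Perm (Dir d)) (τ : Dir d) (x : Site d) {t : ℕ}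
    (ht : t < Function.minimalPeriod π τ) :
    boxNorm (x + ∑ s ∈ Finset.range (t + 1), r ((π ^ s) τ)) ≤ boxNorm x + 1 := by
  refine Finset.sup_le fun i _ => ?_
  have hinj : Set.InjOn (fun s : ℕ => (π ^ s) τ) (Finset.range (t + 1) : Set ℕ) := by
    intro a ha b hb hab
    simp only [Finset.coe_range, Set.mem_Iio] at ha hb
    simp only [Equiv.Perm.coe_pow] at hab
    exact Function.iterate_injOn_Iio_minimalPeriod (Set.mem_Iio.2 (by omega))
      (Set.mem_Iio.2 (by omega)) hab
  rw [← Finset.sum_image (f := r) hinj]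
  have h1 := natAbs_sum_r_le ((Finset.range (t + 1)).image fun s : ℕ => (π ^ s) τ) i
  have h2 : (x i).natAbs ≤ boxNorm x :=
    Finset.le_sup (f := fun i => (x i).natAbs) (Finset.mem_univ i)
  rw [Pi.add_apply]
  exact (Int.natAbs_add_le _ _).trans (by omega)

/-- `ℋ^{Λ_L}` is invariant under `U^L_ω(C)`. -/
theorem decoupledWalk_mem {d : ℕ} {π : Equiv.Perm (Dir d)} (hπ : NoDrift π) (C : Coin d) (L : ℕ)
    (ω : Phases d) : ∀ ψ ∈ boxSpace π L, decoupledWalk π C L ω ψ ∈ boxSpace π L := by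
  suffices h : boxSpace π L ≤ (boxSpace π L).comap (decoupledWalk π C L ω) from
    fun ψ hψ => h hψ
  conv_lhs => unfold boxSpace siteSpace cycleSpace
  refine iSup_le fun x => iSup_le fun hx => iSup_le fun τ => Submodule.span_le.2 ?_
  rintro _ ⟨t, ht, rfl⟩
  have ht' : t < Function.minimalPeriod π τ := ht
  simp only [Submodule.comap_coe, Set.mem_preimage, SetLike.mem_coe]
  have hy := boxNorm_path_le π τ x ht'
  have hsub : ∀ σ y, ket σ y ∈ boxSpace π L → diag ω (ket σ y) ∈ boxSpace π L := by
    intro σ y h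
    rw [diag_ket]
    exact Submodule.smul_mem _ _ h
  set y := x + ∑ s ∈ Finset.range (t + 1), r ((π ^ s) τ) with hydef
  have hket : cycleKet π τ x t = ket ((π ^ t) τ) y := rfl
  rw [hket, decoupledWalk, LinearMap.comp_apply]
  by_cases hb : boxNorm y + 1 = L ∨ boxNorm y = L ∨ boxNorm y = L + 1
  · rw [walk_permCoin_ket π _ _ _ (by rw [boxCoins, if_pos hb])]
    apply hsub
    have hstep : ket (π ((π ^ t) τ)) (y + r (π ((π ^ t) τ))) = cycleKet π τ x (t + 1) := by
      rw [cycleKet, Finset.sum_range_succ, hydef, ← add_assoc, pow_succ', Equiv.Perm.mul_apply]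
    rw [hstep]
    rcases Nat.lt_or_ge (t + 1) (Function.minimalPeriod π τ) with h | h
    · exact cycleKet_mem hx τ h
    · have hm : t + 1 = Function.minimalPeriod π τ := by omega
      have : cycleKet π τ x (t + 1) = cycleKet π τ x 0 := by
        rw [cycleKet, cycleKet, hm, Finset.sum_range_succ, hπ τ, pow_minimalPeriod]
        simp
      rw [this]
      exact cycleKet_mem hx τ (minimalPeriod_pos π τ)
  · rw [walk_ket, map_sum]
    refine Submodule.sum_mem _ fun ρ _ => ?_
    rw [map_smul]
    refine Submodule.smul_mem _ _ (hsub _ _ ?_)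
    have : ket ρ (y + r ρ) = cycleKet π ρ y 0 := by simp [cycleKet]
    rw [this]
    exact cycleKet_mem (by omega) ρ (minimalPeriod_pos π ρ)

/-- `U^{Λ_L}_ω(C)`, the restriction of `U^L_ω(C)` to `ℋ^{Λ_L}`. -/
def boxWalk {d : ℕ} {π : Equiv.Perm (Dir d)} (hπ : NoDrift π) (C : Coin d) (L : ℕ)
    (ω : Phases d) : Module.End ℂ (boxSpace π L) :=
  (decoupledWalk π C L ω).restrict (decoupledWalk_mem hπ C L ω)

/-- The resolvent `R^{Λ_L}_ω(C, z) = (U^{Λ_L}_ω(C) - z)⁻¹` on `ℋ^{Λ_L}`. -/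
def boxResolvent {d : ℕ} {π : Equiv.Perm (Dir d)} (hπ : NoDrift π) (C : Coin d) (L : ℕ)
    (ω : Phases d) (z : ℂ) : Module.End ℂ (boxSpace π L) :=
  Ring.inverse (boxWalk hπ C L ω - z • (1 : Module.End ℂ (boxSpace π L)))

/-- The matrix element `⟨φ| R^{Λ_L}_ω(C, z) |ψ⟩` for `φ, ψ ∈ ℋ^{Λ_L}`. -/
def resolventElement {d : ℕ} {π : Equiv.Perm (Dir d)} (hπ : NoDrift π) (C : Coin d) (L : ℕ)
    (ω : Phases d) (z : ℂ) (φ ψ : boxSpace π L) : ℂ :=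
  inner ℂ (φ : Hilb d) (boxResolvent hπ C L ω z ψ : Hilb d)

/-! ### The probability space -/

/-- `dμ(θ) = l(θ) dθ` with `0 ≤ l ∈ L^∞(𝕋)`. -/
def HasBoundedDensity (μ : MeasureTheory.Measure Torus) : Prop :=
  ∃ l : Torus → ℝ, (∀ θ, 0 ≤ l θ) ∧
    MeasureTheory.MemLp l ⊤ MeasureTheory.volume ∧
    μ = MeasureTheory.volume.withDensity fun θ => ENNReal.ofReal (l θ)

/-- The law `ℙ = ⨂_{τ, y} dμ` of the i.i.d. phases. -/
def phaseLaw (d : ℕ) (μ : MeasureTheory.Measure Torus) [MeasureTheory.IsProbabilityMeasure μ] :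
    MeasureTheory.Measure (Phases d) :=
  MeasureTheory.Measure.infinitePi fun _ : Dir d × Site d => μ

end

end RandomQuantumWalk

open RandomQuantumWalk

namespace RandomQuantumWalk

noncomputable section

open MeasureTheory

/-! ### Fractional means of functions with positive real part -/

/-! Two facts are combined: an a priori bound on fractional moments, uniform in the coins, the
indices and `z` off the unit circle, and one application of the resolvent identity against the walk
with coin `C_π`, which gains a power of `‖C - C_π‖`.

A priori bound (`exists_lintegral_green_le`). The Cayley transform `2 (1 - T)⁻¹ - 1` of a strict
contraction has nonnegative real part. Multiplying the evolution on two basis vectors by a common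
factor `w` keeps it a contraction for `‖w‖ ≤ 1`, so the quadratic form is holomorphic in `w`. The
mean value property for its `t`-th power, `0 < t < 1`, bounds the average over `‖w‖ = 1` by the
value at `w = 0`, which does not see the resolvent. The bounded density lets `μ` be replaced by Haar
measure, whose translation invariance supplies this average; polarization then reaches every matrix
element.

Decay (`exists_lintegral_green_rpow_le`). By the no-drift condition the walk with coin `C_π`
preserves finite blocks of basis vectors of diameter at most 2. For `|x - y| > 2` its Green function
therefore vanishes, and the resolvent identity writes `G(x, y)` as a sum of terms `G₀ (C_π - C) G`
over the block of `x`, with a number of terms independent of `L` (`green_eq_sum`). Since the product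
`G₀ G` would require moments of order `2s`, only a power `q` of `|G|^s` is expanded; the moments
needed have order `s + q < 1`. The outcome is `‖C - C_π‖ ^ q` times a constant, and the hypothesis
on `C` makes this at most a constant times `L ^ (-a)`. -/

theorem norm_rpow_mul_cos_le_re_cpow {w : ℂ} (hw : 0 < w.re) {t : ℝ} (ht0 : 0 < t) (ht1 : t < 1) :
    ‖w‖ ^ t * Real.cos (Real.pi / 2 * t) ≤ (w ^ (t : ℂ)).re := by
  have h0 : w ≠ 0 := by
    rintro rfl
    simp at hw
  have harg := abs_le.1 (Complex.abs_arg_le_pi_div_two_iff.2 hw.le)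
  have hre : (w ^ (t : ℂ)).re = ‖w‖ ^ t * Real.cos (Complex.arg w * t) := by
    rw [Complex.cpow_def_of_ne_zero h0, Complex.exp_re, Complex.re_mul_ofReal,
      Complex.im_mul_ofReal, Complex.log_re, Complex.log_im,
      Real.rpow_def_of_pos (norm_pos_iff.2 h0)]
  rw [hre]
  refine mul_le_mul_of_nonneg_left ?_ (by positivity)
  rw [← Real.cos_abs (Complex.arg w * t), abs_mul, abs_of_pos ht0]
  apply Real.cos_le_cos_of_nonneg_of_le_pi (by positivity)
  · nlinarith [Real.pi_pos]
  · exact mul_le_mul_of_nonneg_right (abs_le.2 harg) ht0.le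

theorem phase_coe (x : ℝ) : phase (x : Torus) = Complex.exp (x * Complex.I) := by
  rw [phase, AddCircle.toCircle_apply_mk, Circle.coe_exp, div_self Real.two_pi_pos.ne', one_mul]

/-- Kolmogorov's argument: the right half-plane avoids the branch cut, so `g ^ t` is holomorphic and
its circle mean is `g 0 ^ t`. As `|arg g| ≤ π / 2`, its real part dominates `cos (π t / 2) ‖g‖ ^ t`.
-/
theorem lintegral_phase_rpow_le {g : ℂ → ℂ} (hd : ∀ w, ‖w‖ ≤ 1 → DifferentiableAt ℂ g w)
    (hre : ∀ w, ‖w‖ ≤ 1 → 0 < (g w).re) {t : ℝ} (ht0 : 0 < t) (ht1 : t < 1) :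
    ∫⁻ α : Torus, ENNReal.ofReal (‖g (phase α)‖ ^ t) ≤
      ENNReal.ofReal (2 * Real.pi * (‖g 0‖ ^ t / Real.cos (Real.pi / 2 * t))) := by
  have hcos : 0 < Real.cos (Real.pi / 2 * t) :=
    Real.cos_pos_of_mem_Ioo ⟨by nlinarith [Real.pi_pos], by nlinarith [Real.pi_pos]⟩
  have hgt : ∀ w, ‖w‖ ≤ 1 → DifferentiableAt ℂ (fun w => g w ^ (t : ℂ)) w := fun w hw =>
    (hd w hw).cpow_const (Or.inl (hre w hw))
  have hmean : Real.circleAverage (fun w => g w ^ (t : ℂ)) 0 1 = g 0 ^ (t : ℂ) := by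
    apply DiffContOnCl.circleAverage
    apply DifferentiableOn.diffContOnCl
    intro w hw
    rw [abs_one, closure_ball _ one_ne_zero, mem_closedBall_zero_iff] at hw
    exact (hgt w hw).differentiableWithinAt
  have hcont : Continuous fun x : ℝ => g (Complex.exp (x * Complex.I)) ^ (t : ℂ) := by
    rw [continuous_iff_continuousAt]
    intro x
    exact ContinuousAt.comp (f := fun x : ℝ => Complex.exp (x * Complex.I))
      (g := fun w => g w ^ (t : ℂ))
      (hgt _ (Complex.norm_exp_ofReal_mul_I x).le).continuousAt (by fun_prop)
  have hint : ∫ x in Set.Ioc (0 : ℝ) (0 + 2 * Real.pi),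
      (g (Complex.exp (x * Complex.I)) ^ (t : ℂ)).re = 2 * Real.pi * (g 0 ^ (t : ℂ)).re := by
    rw [← intervalIntegral.integral_of_le (by linarith [Real.two_pi_pos])]
    have h1 := hmean
    rw [Real.circleAverage_def] at h1
    simp only [circleMap, Complex.ofReal_one, one_mul, zero_add, Complex.real_smul] at h1
    have h2 : ∫ x in (0 : ℝ)..2 * Real.pi, g (Complex.exp (x * Complex.I)) ^ (t : ℂ) =
        ((2 * Real.pi : ℝ) : ℂ) * g 0 ^ (t : ℂ) := by
      rw [← h1, ← mul_assoc, ← Complex.ofReal_mul, mul_inv_cancel₀ Real.two_pi_pos.ne']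
      simp
    have h3 := Complex.reCLM.intervalIntegral_comp_comm (μ := volume)
      (hcont.intervalIntegrable 0 (2 * Real.pi))
    simp only [Complex.reCLM_apply] at h3
    rw [zero_add, h3, h2, Complex.re_ofReal_mul]
  rw [← AddCircle.lintegral_preimage (2 * Real.pi) 0]
  calc ∫⁻ x in Set.Ioc (0 : ℝ) (0 + 2 * Real.pi),
        ENNReal.ofReal (‖g (phase ((x : ℝ) : Torus))‖ ^ t)
      ≤ ∫⁻ x in Set.Ioc (0 : ℝ) (0 + 2 * Real.pi), ENNReal.ofReal
          ((g (Complex.exp (x * Complex.I)) ^ (t : ℂ)).re / Real.cos (Real.pi / 2 * t)) := by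
        refine lintegral_mono fun x => ENNReal.ofReal_le_ofReal ?_
        rw [phase_coe, le_div_iff₀ hcos]
        exact norm_rpow_mul_cos_le_re_cpow
          (hre _ (Complex.norm_exp_ofReal_mul_I x).le) ht0 ht1
    _ = ENNReal.ofReal (2 * Real.pi * (g 0 ^ (t : ℂ)).re / Real.cos (Real.pi / 2 * t)) := by
        rw [← ofReal_integral_eq_lintegral_ofReal, integral_div, hint]
        · exact ((Complex.continuous_re.comp hcont).div_const _).integrableOn_Ioc
        · refine Filter.Eventually.of_forall fun x => div_nonneg ?_ hcos.le
          refine le_trans ?_ (norm_rpow_mul_cos_le_re_cpow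
            (hre _ (Complex.norm_exp_ofReal_mul_I x).le) ht0 ht1)
          positivity
    _ ≤ _ := by
        rw [mul_div_assoc]
        refine ENNReal.ofReal_le_ofReal (mul_le_mul_of_nonneg_left ?_ Real.two_pi_pos.le)
        refine div_le_div_of_nonneg_right ?_ hcos.le
        refine (Complex.re_le_norm _).trans ?_
        rw [Complex.norm_cpow_real]

/-! ### The resolvent of a contraction inside the unit disc -/

section Neumann

variable {E : Type*} [NormedAddCommGroup E] [InnerProductSpace ℂ E] [CompleteSpace E]

/-- `(1 - T)⁻¹`, for `‖T‖ < 1` the sum of the Neumann series. -/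
def neumann (T : E →L[ℂ] E) : E →L[ℂ] E := Ring.inverse (1 - T)

theorem neumann_sub_apply {T : E →L[ℂ] E} (hT : ‖T‖ < 1) (x : E) :
    neumann T x - T (neumann T x) = x := by
  have h := Ring.mul_inverse_cancel _ (isUnit_one_sub_of_norm_lt_one hT)
  simpa [neumann] using congrArg (fun A : E →L[ℂ] E => A x) h

theorem neumann_apply_sub {T : E →L[ℂ] E} (hT : ‖T‖ < 1) (x : E) :
    neumann T (x - T x) = x := by
  have h := Ring.inverse_mul_cancel _ (isUnit_one_sub_of_norm_lt_one hT)
  simpa [neumann] using congrArg (fun A : E →L[ℂ] E => A x) h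

theorem hasSum_neumann_apply {T : E →L[ℂ] E} (hT : ‖T‖ < 1) (x : E) :
    HasSum (fun n : ℕ => (T ^ n) x) (neumann T x) :=
  (ContinuousLinearMap.apply ℂ E x).hasSum (hasSum_geom_series_inverse T hT)

theorem norm_smul_lt_one {U : E →L[ℂ] E} (hU : ‖U‖ ≤ 1) {ζ : ℂ} (hζ : ‖ζ‖ < 1) :
    ‖ζ • U‖ < 1 := by
  rw [norm_smul]
  nlinarith [norm_nonneg ζ, norm_nonneg U]

/-- With `y = (1 - T)⁻¹ x` the form equals `⟪y - T y, y + T y⟫`, whose real part is `‖y‖ ^ 2 - ‖T y‖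
^ 2`. -/
theorem re_inner_cayley_nonneg {T : E →L[ℂ] E} (hT : ‖T‖ < 1) (x : E) :
    0 ≤ (inner ℂ x ((2 : ℂ) • neumann T x - x)).re := by
  set y := neumann T x with hy
  have hx : y - T y = x := neumann_sub_apply hT x
  have h1 : (2 : ℂ) • y - x = y + T y := by
    rw [← hx, two_smul]
    abel
  rw [h1, ← hx, inner_sub_left, inner_add_right, inner_add_right]
  have h2 : ‖T y‖ ≤ ‖y‖ := by
    refine (T.le_opNorm y).trans ?_
    nlinarith [norm_nonneg y]
  have h3 : (inner ℂ (T y) y : ℂ).re = (inner ℂ y (T y) : ℂ).re := by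
    rw [← inner_conj_symm, Complex.conj_re]
  have h4 : (inner ℂ y y : ℂ).re = ‖y‖ ^ 2 := (norm_sq_eq_re_inner (𝕜 := ℂ) y).symm
  have h5 : (inner ℂ (T y) (T y) : ℂ).re = ‖T y‖ ^ 2 :=
    (norm_sq_eq_re_inner (𝕜 := ℂ) (T y)).symm
  simp only [Complex.sub_re, Complex.add_re, h3, h4, h5]
  nlinarith [norm_nonneg y, norm_nonneg (T y)]

/-- Averaging over the common phase of the range of `P` bounds the fractional moments of the
quadratic form of the Cayley transform. -/
theorem lintegral_cayley_rpow_le {U P : E →L[ℂ] E} (hU : ‖U‖ ≤ 1)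
    (hP : ∀ w : ℂ, ‖w‖ ≤ 1 → ‖1 - P + w • P‖ ≤ 1) {x : E}
    (hx : ∀ y, inner ℂ x (P y) = inner ℂ x y) {ζ : ℂ} (hζ : ‖ζ‖ < 1) {t : ℝ}
    (ht0 : 0 < t) (ht1 : t < 1) :
    ∫⁻ α : Torus, ENNReal.ofReal (‖inner ℂ x
        ((2 : ℂ) • neumann (ζ • ((1 - P + phase α • P) * U)) x - x)‖ ^ t) ≤
      ENNReal.ofReal (2 * Real.pi * ((‖x‖ ^ 2 + 1) ^ t / Real.cos (Real.pi / 2 * t))) := by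
  have hT : ∀ w : ℂ, ‖w‖ ≤ 1 → ‖ζ • ((1 - P + w • P) * U)‖ < 1 := fun w hw =>
    norm_smul_lt_one ((norm_mul_le _ _).trans
      (mul_le_one₀ (hP w hw) (norm_nonneg _) hU)) hζ
  -- Adding 1 makes the real part strictly positive, as the complex power requires.
  set g : ℂ → ℂ := fun w => inner ℂ x
    ((2 : ℂ) • neumann (ζ • ((1 - P + w • P) * U)) x - x) + 1 with hg
  have hre : ∀ w, ‖w‖ ≤ 1 → 0 < (g w).re := by
    intro w hw
    have := re_inner_cayley_nonneg (hT w hw) x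
    simp only [hg, Complex.add_re, Complex.one_re]
    linarith
  have hd : ∀ w, ‖w‖ ≤ 1 → DifferentiableAt ℂ g w := by
    intro w hw
    have h1 : DifferentiableAt ℂ (fun w : ℂ => 1 - ζ • ((1 - P + w • P) * U)) w := by
      fun_prop
    have h2 : DifferentiableAt ℂ (fun w : ℂ => neumann (ζ • ((1 - P + w • P) * U))) w :=
      (differentiableAt_inverse (𝕜 := ℂ) (isUnit_one_sub_of_norm_lt_one (hT w hw))).comp w h1
    have h3 : DifferentiableAt ℂ (fun w : ℂ => neumann (ζ • ((1 - P + w • P) * U)) x) w :=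
      h2.clm_apply (differentiableAt_const x)
    have h4 := ((innerSL ℂ x).differentiableAt (x := (2 : ℂ) •
      neumann (ζ • ((1 - P + w • P) * U)) x - x)).comp w
        ((h3.const_smul (2 : ℂ)).sub_const x)
    exact h4.add_const 1
  -- At `w = 0` the evolution maps into the range of `1 - P`, to which `x` is orthogonal, so only
  -- the identity term of the resolvent contributes.
  have h0 : ‖g 0‖ = ‖x‖ ^ 2 + 1 := by
    have hN := neumann_sub_apply (hT 0 (by simp)) x
    set y := neumann (ζ • ((1 - P + (0 : ℂ) • P) * U)) x with hy
    have hxy : inner ℂ x y = inner ℂ x x := by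
      have h1 : inner ℂ x ((ζ • ((1 - P + (0 : ℂ) • P) * U)) y) = 0 := by
        simp [hx]
      conv_rhs => rw [show inner ℂ x x = inner ℂ x (y - (ζ • ((1 - P + (0 : ℂ) • P) * U)) y) by
        rw [hN], inner_sub_right, h1, sub_zero]
    have : g 0 = ((‖x‖ ^ 2 + 1 : ℝ) : ℂ) := by
      simp only [hg]
      rw [← hy, inner_sub_right, inner_smul_right, hxy, inner_self_eq_norm_sq_to_K]
      push_cast
      simp
      ring
    rw [this, Complex.norm_real, Real.norm_of_nonneg (by positivity)]
  rw [← h0]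
  refine le_trans (lintegral_mono fun α => ENNReal.ofReal_le_ofReal ?_)
    (lintegral_phase_rpow_le hd hre ht0 ht1)
  -- The added 1 is harmless: `‖h‖ ≤ ‖h + 1‖` whenever `0 ≤ h.re`.
  refine Real.rpow_le_rpow (norm_nonneg _) ?_ ht0.le
  have h1 := re_inner_cayley_nonneg (hT (phase α) (norm_phase α).le) x
  set h : ℂ := inner ℂ x ((2 : ℂ) • neumann (ζ • ((1 - P + phase α • P) * U)) x - x)
  change ‖h‖ ≤ ‖h + 1‖
  rw [← sq_le_sq₀ (norm_nonneg _) (norm_nonneg _), Complex.sq_norm, Complex.sq_norm,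
    Complex.normSq_apply, Complex.normSq_apply]
  simp only [Complex.add_re, Complex.add_im, Complex.one_re, Complex.one_im]
  nlinarith

end Neumann

/-! ### Resampling and shifting finitely many phases -/

section Resample

variable {ι Ω : Type*} [DecidableEq ι] [MeasurableSpace Ω]

theorem measurable_update_prod (i : ι) :
    Measurable fun p : (ι → Ω) × Ω => Function.update p.1 i p.2 := by
  refine measurable_pi_lambda _ fun k => ?_
  by_cases h : k = i
  · subst h
    simpa using measurable_snd
  · simp only [Function.update_of_ne h]
    exact (measurable_pi_apply k).comp measurable_fst

/-- Both measures agree on finite cylinders: the fresh variable supplies the factor at `i` if `i` is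
constrained, and a factor 1 otherwise. -/
theorem map_update_infinitePi_prod (μ : Measure Ω) [IsProbabilityMeasure μ] (i : ι) :
    ((Measure.infinitePi fun _ : ι => μ).prod μ).map
      (fun p => Function.update p.1 i p.2) = Measure.infinitePi fun _ : ι => μ := by
  refine Measure.eq_infinitePi _ fun s t ht => ?_
  rw [Measure.map_apply (measurable_update_prod i)
    (MeasurableSet.pi s.countable_toSet fun k _ => ht k)]
  by_cases hi : i ∈ s
  · have h : (fun p : (ι → Ω) × Ω => Function.update p.1 i p.2) ⁻¹' Set.pi s t =
        Set.pi (s.erase i : Finset ι) t ×ˢ t i := by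
      ext ⟨ω, x⟩
      simp only [Set.mem_preimage, Set.mem_pi, Set.mem_prod, Finset.mem_coe, Finset.mem_erase]
      constructor
      · intro h
        refine ⟨fun k hk => ?_, by simpa using h i hi⟩
        simpa [hk.1] using h k hk.2
      · rintro ⟨h1, h2⟩ k hk
        by_cases hki : k = i
        · subst hki
          simpa using h2
        · simpa [hki] using h1 k ⟨hki, hk⟩
    rw [h, Measure.prod_prod, Measure.infinitePi_pi _ fun k _ => ht k, mul_comm,
      Finset.mul_prod_erase s (fun k => μ (t k)) hi]
  · have h : (fun p : (ι → Ω) × Ω => Function.update p.1 i p.2) ⁻¹' Set.pi s t =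
        Set.pi s t ×ˢ Set.univ := by
      ext ⟨ω, x⟩
      simp only [Set.mem_preimage, Set.mem_pi, Set.mem_prod, Finset.mem_coe, Set.mem_univ,
        and_true]
      refine forall₂_congr fun k hk => ?_
      rw [Function.update_of_ne (ne_of_mem_of_not_mem hk hi)]
    rw [h, Measure.prod_prod, Measure.infinitePi_pi _ fun k _ => ht k, measure_univ, mul_one]

theorem lintegral_infinitePi_update (μ : Measure Ω) [IsProbabilityMeasure μ] (i : ι)
    {f : (ι → Ω) → ENNReal} (hf : Measurable f) :
    ∫⁻ ω, f ω ∂(Measure.infinitePi fun _ : ι => μ) =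
      ∫⁻ ω, ∫⁻ x, f (Function.update ω i x) ∂μ ∂(Measure.infinitePi fun _ : ι => μ) := by
  conv_lhs => rw [← map_update_infinitePi_prod μ i]
  rw [lintegral_map hf (measurable_update_prod i)]
  exact lintegral_prod _ (hf.comp (measurable_update_prod i)).aemeasurable

end Resample

theorem HasBoundedDensity.exists_le_smul_volume {μ : Measure Torus} (hμ : HasBoundedDensity μ) :
    ∃ M : NNReal, μ ≤ M • (volume : Measure Torus) := by
  obtain ⟨l, hl0, hl, rfl⟩ := hμ
  refine ⟨(eLpNorm l ⊤ volume).toNNReal, ?_⟩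
  have h1 : ((eLpNorm l ⊤ volume).toNNReal : ENNReal) = eLpNorm l ⊤ volume :=
    ENNReal.coe_toNNReal hl.2.ne
  have h2 : (fun θ => ENNReal.ofReal (l θ)) ≤ᵐ[volume]
      fun _ => ((eLpNorm l ⊤ volume).toNNReal : ENNReal) := by
    filter_upwards [ae_le_eLpNormEssSup (f := l) (μ := (volume : Measure Torus))] with θ hθ
    rw [h1, eLpNorm_exponent_top]
    rwa [← Real.enorm_of_nonneg (hl0 θ)]
  refine (withDensity_mono h2).trans ?_
  rw [withDensity_const]
  exact le_rfl

/-- The phases `ω` with `α` added at all the indices in `A`. -/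
def shiftPhases {d : ℕ} (A : Finset (Dir d × Site d)) (α : Torus) (ω : Phases d) : Phases d :=
  fun k => if k ∈ A then α + ω k else ω k

theorem shiftPhases_update {d : ℕ} {i j : Dir d × Site d} (hij : i ≠ j) (α x y : Torus)
    (ω : Phases d) : shiftPhases {i, j} α (Function.update (Function.update ω j y) i x) =
      Function.update (Function.update ω j (α + y)) i (α + x) := by
  ext k
  by_cases hi : k = i
  · subst hi
    simp [shiftPhases]
  · by_cases hj : k = j
    · subst hj
      simp [shiftPhases, hi]
    · simp [shiftPhases, hi, hj]

/-- By translation invariance the double integral is unchanged by a diagonal shift `α`. Averaging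
over `α` and exchanging integrals puts the `α`-integral innermost, where `hS` applies. -/
theorem lintegral_lintegral_torus_le {g : Torus → Torus → ENNReal}
    (hg : Measurable fun p : Torus × Torus => g p.1 p.2) {S : ENNReal}
    (hS : ∀ x y, ∫⁻ α, g (α + x) (α + y) ≤ S) :
    ∫⁻ y, ∫⁻ x, g x y ≤ ENNReal.ofReal (2 * Real.pi) * S := by
  have hT : (volume : Measure Torus) Set.univ = ENNReal.ofReal (2 * Real.pi) :=
    AddCircle.measure_univ _
  have hT0 : ENNReal.ofReal (2 * Real.pi) ≠ 0 := by
    simpa using Real.two_pi_pos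
  have hT1 : ENNReal.ofReal (2 * Real.pi) ≠ ⊤ := ENNReal.ofReal_ne_top
  have hshift : ∀ α : Torus, ∫⁻ y, ∫⁻ x, g (α + x) (α + y) = ∫⁻ y, ∫⁻ x, g x y := by
    intro α
    rw [← lintegral_add_left_eq_self (μ := volume) (fun y => ∫⁻ x, g x y) α]
    refine lintegral_congr fun y => ?_
    exact lintegral_add_left_eq_self (μ := volume) (fun x => g x (α + y)) α
  have h1 : ENNReal.ofReal (2 * Real.pi) * ∫⁻ y, ∫⁻ x, g x y =
      ∫⁻ α : Torus, ∫⁻ y, ∫⁻ x, g (α + x) (α + y) := by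
    simp_rw [hshift]
    rw [lintegral_const, hT, mul_comm]
  have hm : Measurable fun p : (Torus × Torus) × Torus => g (p.1.1 + p.2) (p.1.1 + p.1.2) :=
    hg.comp (((measurable_fst.comp measurable_fst).add measurable_snd).prodMk
      ((measurable_fst.comp measurable_fst).add (measurable_snd.comp measurable_fst)))
  have h2 : ∫⁻ α : Torus, ∫⁻ y, ∫⁻ x, g (α + x) (α + y) =
      ∫⁻ y, ∫⁻ x, ∫⁻ α : Torus, g (α + x) (α + y) := by
    rw [lintegral_lintegral_swap]
    · refine lintegral_congr fun y => ?_
      rw [lintegral_lintegral_swap]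
      exact (hg.comp ((measurable_fst.add measurable_snd).prodMk
        (measurable_fst.add_const y))).aemeasurable
    · exact (Measurable.lintegral_prod_right' hm).aemeasurable
  have h3 : ∫⁻ y : Torus, ∫⁻ x : Torus, ∫⁻ α : Torus, g (α + x) (α + y) ≤
      ENNReal.ofReal (2 * Real.pi) * (ENNReal.ofReal (2 * Real.pi) * S) := by
    refine (lintegral_mono fun y => lintegral_mono fun x => hS x y).trans ?_
    rw [lintegral_const, lintegral_const, hT]
    exact le_of_eq (by ring)
  rw [← h2, ← h1] at h3
  exact (ENNReal.mul_le_mul_iff_right hT0 hT1).1 h3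

/-- Reduces a moment bound to averaging over one common phase: the phases at `i` and `j` are
resampled, their law is dominated by `M` times Haar measure, and the diagonal shift is then free. -/
theorem lintegral_phaseLaw_le_of_shift {d : ℕ} {μ : Measure Torus} [IsProbabilityMeasure μ]
    {M : NNReal} (hM : μ ≤ M • (volume : Measure Torus)) {i j : Dir d × Site d} (hij : i ≠ j)
    {f : Phases d → ENNReal} (hf : Measurable f) {S : ENNReal}
    (hS : ∀ ω, ∫⁻ α, f (shiftPhases {i, j} α ω) ≤ S) :
    ∫⁻ ω, f ω ∂(phaseLaw d μ) ≤ M * (M * (ENNReal.ofReal (2 * Real.pi) * S)) := by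
  have h1 : Measurable fun ω : Phases d => ∫⁻ x, f (Function.update ω i x) ∂μ :=
    Measurable.lintegral_prod_right' (hf.comp (measurable_update_prod i))
  rw [phaseLaw, lintegral_infinitePi_update μ i hf, lintegral_infinitePi_update μ j h1]
  have h2 : ∀ ω : Phases d,
      ∫⁻ y, ∫⁻ x, f (Function.update (Function.update ω j y) i x) ∂μ ∂μ ≤
        M * (M * (ENNReal.ofReal (2 * Real.pi) * S)) := by
    intro ω
    calc ∫⁻ y, ∫⁻ x, f (Function.update (Function.update ω j y) i x) ∂μ ∂μ
        ≤ ∫⁻ y, ∫⁻ x, f (Function.update (Function.update ω j y) i x) ∂(M • volume)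
            ∂(M • volume) :=
          lintegral_mono' hM fun y => lintegral_mono' hM fun x => le_rfl
      _ = M * (M * ∫⁻ y, ∫⁻ x, f (Function.update (Function.update ω j y) i x)) := by
          simp_rw [lintegral_smul_measure, ENNReal.smul_def, smul_eq_mul]
          rw [lintegral_const_mul' _ _ ENNReal.coe_ne_top]
      _ ≤ _ := by
          gcongr
          refine lintegral_lintegral_torus_le ?_ fun x y => ?_
          · refine hf.comp (measurable_pi_lambda _ fun k => ?_)
            by_cases hki : k = i
            · subst hki
              simpa using measurable_fst
            · by_cases hkj : k = j
              · subst hkj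
                simpa [hki] using measurable_snd
              · simp [hki, hkj]
          · simp_rw [← shiftPhases_update hij]
            exact hS _
  refine (lintegral_mono h2).trans ?_
  rw [lintegral_const, measure_univ, mul_one]

/-! ### Multiplication operators and the one step evolution as bounded operators -/

section Operators

variable {d : ℕ}

theorem Hilb.hasSum_norm_sq (ψ : Hilb d) : HasSum (fun i => ‖ψ i‖ ^ 2) (‖ψ‖ ^ 2) := by
  have h := lp.hasSum_norm (p := 2) (by norm_num) ψ
  simpa using h

theorem Hilb.ofReal_norm_sq (ψ : Hilb d) :
    ENNReal.ofReal (‖ψ‖ ^ 2) = ∑' i, ENNReal.ofReal (‖ψ i‖ ^ 2) := by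
  rw [← (Hilb.hasSum_norm_sq ψ).tsum_eq,
    ENNReal.ofReal_tsum_of_nonneg (fun i => by positivity) (Hilb.hasSum_norm_sq ψ).summable]

theorem Hilb.norm_le_of_forall_le {ψ φ : Hilb d} (h : ∀ i, ‖ψ i‖ ≤ ‖φ i‖) : ‖ψ‖ ≤ ‖φ‖ := by
  rw [← sq_le_sq₀ (norm_nonneg _) (norm_nonneg _)]
  exact hasSum_le (fun i => pow_le_pow_left₀ (norm_nonneg _) (h i) 2)
    (Hilb.hasSum_norm_sq ψ) (Hilb.hasSum_norm_sq φ)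

theorem memℓp_mul {g : Dir d × Site d → ℂ} (hg : ∀ i, ‖g i‖ ≤ 1) (ψ : Hilb d) :
    Memℓp (E := fun _ : Dir d × Site d => ℂ) (fun i => g i * ψ i) 2 := by
  apply memℓp_gen
  refine Summable.of_nonneg_of_le (fun i => by positivity) (fun i => ?_)
    ((memℓp_gen_iff (by norm_num)).1 (lp.memℓp ψ))
  refine Real.rpow_le_rpow (norm_nonneg _) ?_ (by norm_num)
  rw [norm_mul]
  exact mul_le_of_le_one_left (norm_nonneg _) (hg i)

/-- Multiplication by a function bounded by one. -/
def mulOp (g : Dir d × Site d → ℂ) (hg : ∀ i, ‖g i‖ ≤ 1) : Hilb d →L[ℂ] Hilb d :=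
  LinearMap.mkContinuous
    { toFun := fun ψ => ⟨fun i => g i * ψ i, memℓp_mul hg ψ⟩
      map_add' := fun ψ φ => by
        ext i
        exact mul_add _ _ _
      map_smul' := fun c ψ => by
        ext i
        exact mul_left_comm _ _ _ } 1 fun ψ => by
    rw [one_mul]
    refine Hilb.norm_le_of_forall_le fun i => ?_
    exact (norm_mul_le _ _).trans (mul_le_of_le_one_left (norm_nonneg _) (hg i))

theorem mulOp_apply (g : Dir d × Site d → ℂ) (hg : ∀ i, ‖g i‖ ≤ 1) (ψ : Hilb d)
    (i : Dir d × Site d) : mulOp g hg ψ i = g i * ψ i := rfl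

theorem norm_mulOp_le (g : Dir d × Site d → ℂ) (hg : ∀ i, ‖g i‖ ≤ 1) : ‖mulOp g hg‖ ≤ 1 :=
  LinearMap.mkContinuous_norm_le _ zero_le_one _

/-- The projection onto the coordinates in `A`. -/
def coordProj (A : Finset (Dir d × Site d)) : Hilb d →L[ℂ] Hilb d :=
  mulOp (fun i => if i ∈ A then 1 else 0) fun i => by split_ifs <;> simp

theorem coordProj_apply (A : Finset (Dir d × Site d)) (ψ : Hilb d) (i : Dir d × Site d) :
    coordProj A ψ i = if i ∈ A then ψ i else 0 := by
  simp [coordProj, mulOp_apply]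

theorem norm_one_sub_coordProj_add_le (A : Finset (Dir d × Site d)) {w : ℂ} (hw : ‖w‖ ≤ 1) :
    ‖1 - coordProj A + w • coordProj A‖ ≤ 1 := by
  have hg : ∀ i : Dir d × Site d, ‖(if i ∈ A then w else 1 : ℂ)‖ ≤ 1 := fun i => by
    split_ifs <;> simp [hw]
  have h : 1 - coordProj A + w • coordProj A = mulOp (fun i => if i ∈ A then w else 1) hg := by
    ext ψ i
    change ψ i - coordProj A ψ i + w * coordProj A ψ i = _
    rw [mulOp_apply, coordProj_apply]
    split_ifs <;> simp
  rw [h]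
  exact norm_mulOp_le _ _

theorem inner_ket (τ : Dir d) (x : Site d) (ψ : Hilb d) : inner ℂ (ket τ x) ψ = ψ (τ, x) := by
  rw [ket, lp.inner_single_left]
  simp

theorem ket_apply (τ : Dir d) (x : Site d) (i : Dir d × Site d) :
    ket τ x i = if i = (τ, x) then 1 else 0 := by
  rw [ket, lp.single_apply, Pi.single_apply]

theorem inner_coordProj {A : Finset (Dir d × Site d)} {φ : Hilb d} (hφ : ∀ i ∉ A, φ i = 0)
    (ψ : Hilb d) : inner ℂ φ (coordProj A ψ) = inner ℂ φ ψ := by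
  rw [lp.inner_eq_tsum, lp.inner_eq_tsum]
  refine tsum_congr fun i => ?_
  rw [coordProj_apply]
  split_ifs with h
  · rfl
  · simp [hφ i h]

theorem coordProj_eq_sum (A : Finset (Dir d × Site d)) (ψ : Hilb d) :
    coordProj A ψ = ∑ k ∈ A, ψ k • ket k.1 k.2 := by
  ext i
  rw [coordProj_apply, lp.coeFn_sum, Finset.sum_apply]
  simp [ket_apply]

theorem sum_norm_sq_mulVec (C : Coin d) (v : Dir d → ℂ) :
    ∑ τ, ‖∑ σ, (C : Matrix (Dir d) (Dir d) ℂ) τ σ * v σ‖ ^ 2 = ∑ σ, ‖v σ‖ ^ 2 := by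
  have key : ∀ u : Dir d → ℂ, ((∑ σ, ‖u σ‖ ^ 2 : ℝ) : ℂ) = star u ⬝ᵥ u := by
    intro u
    rw [dotProduct]
    push_cast
    refine Finset.sum_congr rfl fun σ _ => ?_
    rw [Pi.star_apply, ← Complex.conj_mul']
    rfl
  have h : star ((C : Matrix (Dir d) (Dir d) ℂ).mulVec v) ⬝ᵥ
      (C : Matrix (Dir d) (Dir d) ℂ).mulVec v = star v ⬝ᵥ v := by
    rw [Matrix.star_mulVec, Matrix.dotProduct_mulVec, Matrix.vecMul_vecMul,
      ← Matrix.star_eq_conjTranspose, Matrix.mem_unitaryGroup_iff'.1 C.2, Matrix.vecMul_one]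
  rw [← key, ← key] at h
  exact_mod_cast h

theorem tsum_dir_site (F : Dir d × Site d → ENNReal) :
    ∑' i, F i = ∑ τ, ∑' x, F (τ, x) := by
  rw [ENNReal.tsum_prod' (f := F), tsum_fintype]

/-- Regrouping the coordinates by departure site turns the squared norm into a sum over `y` of `‖C_y
ψ(·, y)‖ ^ 2`, and each coin is unitary. Sums in `ENNReal` make the exchange unconditional. -/
theorem norm_walk (C : Site d → Coin d) (ψ : Hilb d) : ‖walk C ψ‖ = ‖ψ‖ := by
  rw [← sq_eq_sq₀ (norm_nonneg _) (norm_nonneg _),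
    ← ENNReal.ofReal_eq_ofReal_iff (by positivity) (by positivity), Hilb.ofReal_norm_sq,
    Hilb.ofReal_norm_sq, tsum_dir_site, tsum_dir_site]
  have h1 : ∀ τ : Dir d, ∑' x : Site d, ENNReal.ofReal (‖walk C ψ (τ, x)‖ ^ 2) =
      ∑' y : Site d, ENNReal.ofReal
        (‖∑ σ, (C y : Matrix (Dir d) (Dir d) ℂ) τ σ * ψ (σ, y)‖ ^ 2) := fun τ =>
    (Equiv.subRight (r τ)).tsum_eq fun y : Site d => ENNReal.ofReal
      (‖∑ σ, (C y : Matrix (Dir d) (Dir d) ℂ) τ σ * ψ (σ, y)‖ ^ 2)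
  simp_rw [h1]
  rw [← Summable.tsum_finsetSum fun _ _ => ENNReal.summable,
    ← Summable.tsum_finsetSum fun _ _ => ENNReal.summable]
  refine tsum_congr fun y => ?_
  rw [← ENNReal.ofReal_sum_of_nonneg (fun _ _ => by positivity),
    ← ENNReal.ofReal_sum_of_nonneg (fun _ _ => by positivity),
    sum_norm_sq_mulVec (C y) fun σ => ψ (σ, y)]

theorem norm_diag (ω : Phases d) (ψ : Hilb d) : ‖diag ω ψ‖ = ‖ψ‖ := by
  have h : ∀ i, ‖diag ω ψ i‖ = ‖ψ i‖ := by
    intro i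
    change ‖phase (ω i) * ψ i‖ = _
    rw [norm_mul, norm_phase, one_mul]
  exact le_antisymm (Hilb.norm_le_of_forall_le fun i => (h i).le)
    (Hilb.norm_le_of_forall_le fun i => (h i).ge)

/-- The one step evolution `𝔻(ω) 𝕊(𝒞)`, a linear isometry. -/
def evolution (C : Site d → Coin d) (ω : Phases d) : Hilb d →ₗᵢ[ℂ] Hilb d where
  toLinearMap := diag ω ∘ₗ walk C
  norm_map' ψ := by rw [LinearMap.comp_apply, norm_diag, norm_walk]

theorem evolution_apply (C : Site d → Coin d) (ω : Phases d) (ψ : Hilb d) (i : Dir d × Site d) :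
    evolution C ω ψ i = phase (ω i) *
      ∑ σ, (C (i.2 - r i.1) : Matrix (Dir d) (Dir d) ℂ) i.1 σ * ψ (σ, i.2 - r i.1) := rfl

/-- The one step evolution as a bounded operator. -/
def evolutionCLM (C : Site d → Coin d) (ω : Phases d) : Hilb d →L[ℂ] Hilb d :=
  (evolution C ω).toContinuousLinearMap

theorem evolutionCLM_apply (C : Site d → Coin d) (ω : Phases d) (ψ : Hilb d) :
    evolutionCLM C ω ψ = evolution C ω ψ := rfl

theorem norm_evolutionCLM_le (C : Site d → Coin d) (ω : Phases d) : ‖evolutionCLM C ω‖ ≤ 1 :=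
  (evolution C ω).norm_toContinuousLinearMap_le

theorem phase_add (α β : Torus) : phase (α + β) = phase α * phase β := by
  rw [phase, AddCircle.toCircle_add, Circle.coe_mul, phase, phase]

theorem evolutionCLM_shiftPhases (C : Site d → Coin d) (A : Finset (Dir d × Site d)) (α : Torus)
    (ω : Phases d) : evolutionCLM C (shiftPhases A α ω) =
      (1 - coordProj A + phase α • coordProj A) * evolutionCLM C ω := by
  ext ψ i
  set φ := evolutionCLM C ω ψ with hφ
  change evolution C (shiftPhases A α ω) ψ i = φ i - coordProj A φ i + phase α * coordProj A φ i
  rw [coordProj_apply, hφ, evolutionCLM_apply, evolution_apply, evolution_apply, shiftPhases]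
  split_ifs
  · rw [phase_add]
    ring
  · ring

end Operators

/-! ### Fractional moments of the Green function -/

section Moments

variable {d : ℕ}

theorem norm_ket (τ : Dir d) (x : Site d) : ‖ket τ x‖ = 1 := by
  rw [ket, lp.norm_single (by norm_num)]
  simp

/-- The matrix element `⟨i| (1 - ζ 𝔻(ω) 𝕊(𝒞))⁻¹ |j⟩`. -/
def neumannElement (C : Site d → Coin d) (ζ : ℂ) (i j : Dir d × Site d) (ω : Phases d) : ℂ :=
  inner ℂ (ket i.1 i.2) (neumann (ζ • evolutionCLM C ω) (ket j.1 j.2))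

theorem norm_smul_evolutionCLM_lt (C : Site d → Coin d) (ω : Phases d) {ζ : ℂ} (hζ : ‖ζ‖ < 1) :
    ‖ζ • evolutionCLM C ω‖ < 1 :=
  norm_smul_lt_one (norm_evolutionCLM_le C ω) hζ

theorem continuous_phase : Continuous phase :=
  continuous_subtype_val.comp AddCircle.continuous_toCircle

theorem measurable_evolution_apply (C : Site d → Coin d) {Ψ : Phases d → Hilb d}
    (hΨ : ∀ i, Measurable fun ω => Ψ ω i) (i : Dir d × Site d) :
    Measurable fun ω => evolution C ω (Ψ ω) i := by
  simp_rw [evolution_apply]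
  exact (continuous_phase.measurable.comp (measurable_pi_apply i)).mul
    (Finset.measurable_fun_sum _ fun σ _ => (hΨ _).const_mul _)

/-- A pointwise limit of Neumann partial sums, each step of the evolution being a finite sum in
coordinates. -/
theorem measurable_neumann_apply (C : Site d → Coin d) {ζ : ℂ} (hζ : ‖ζ‖ < 1) (φ : Hilb d)
    (i : Dir d × Site d) :
    Measurable fun ω => neumann (ζ • evolutionCLM C ω) φ i := by
  have hpow : ∀ (n : ℕ) (i : Dir d × Site d),
      Measurable fun ω => ((ζ • evolutionCLM C ω) ^ n) φ i := by
    intro n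
    induction n with
    | zero =>
      intro i
      simp_rw [pow_zero]
      exact measurable_const
    | succ n ih =>
      intro i
      have h := (measurable_evolution_apply C ih i).const_mul ζ
      simp_rw [pow_succ']
      exact h
  refine measurable_of_tendsto_metrizable (f := fun n ω => ∑ k ∈ Finset.range n,
    ((ζ • evolutionCLM C ω) ^ k) φ i) (fun n => Finset.measurable_fun_sum _ fun k _ => hpow k i) ?_
  rw [tendsto_pi_nhds]
  intro ω
  have h := hasSum_neumann_apply (norm_smul_evolutionCLM_lt C ω hζ) φ
  have h2 := (innerSL ℂ (ket i.1 i.2)).hasSum h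
  simp only [innerSL_apply_apply, inner_ket] at h2
  exact h2.tendsto_sum_nat

theorem measurable_neumannElement (C : Site d → Coin d) {ζ : ℂ} (hζ : ‖ζ‖ < 1)
    (i j : Dir d × Site d) : Measurable (neumannElement C ζ i j) := by
  unfold neumannElement
  simp_rw [inner_ket]
  exact measurable_neumann_apply C hζ _ _

theorem inner_eq_sum_of_support {A : Finset (Dir d × Site d)} {φ : Hilb d}
    (hφ : ∀ i ∉ A, φ i = 0) (ψ : Hilb d) : inner ℂ φ ψ = ∑ k ∈ A, inner ℂ (φ k) (ψ k) := by
  rw [lp.inner_eq_tsum]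
  exact tsum_eq_sum fun k hk => by simp [hφ k hk]

/-- Fractional moments of the quadratic form of the Cayley transform at a vector carried by two
indices. -/
theorem lintegral_phaseLaw_cayley_le {μ : Measure Torus} [IsProbabilityMeasure μ] {M : NNReal}
    (hM : μ ≤ M • (volume : Measure Torus)) {t : ℝ} (ht0 : 0 < t) (ht1 : t < 1)
    (C : Site d → Coin d) {ζ : ℂ} (hζ : ‖ζ‖ < 1) {k l : Dir d × Site d} (hkl : k ≠ l)
    {φ : Hilb d} (hφ : ∀ i ∉ ({k, l} : Finset (Dir d × Site d)), φ i = 0) (hφ2 : ‖φ‖ ≤ 2) :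
    ∫⁻ ω, ENNReal.ofReal (‖inner ℂ φ
        ((2 : ℂ) • neumann (ζ • evolutionCLM C ω) φ - φ)‖ ^ t) ∂(phaseLaw d μ) ≤
      M * (M * (ENNReal.ofReal (2 * Real.pi) *
        ENNReal.ofReal (2 * Real.pi * (5 ^ t / Real.cos (Real.pi / 2 * t))))) := by
  have hcos : 0 < Real.cos (Real.pi / 2 * t) :=
    Real.cos_pos_of_mem_Ioo ⟨by nlinarith [Real.pi_pos], by nlinarith [Real.pi_pos]⟩
  refine lintegral_phaseLaw_le_of_shift hM hkl ?_ fun ω => ?_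
  · refine ENNReal.measurable_ofReal.comp (Measurable.pow_const (Measurable.norm ?_) t)
    simp_rw [inner_eq_sum_of_support hφ]
    refine Finset.measurable_fun_sum _ fun i _ => ?_
    exact Measurable.const_inner
      (((measurable_neumann_apply C hζ φ i).const_mul 2).sub measurable_const)
  · simp_rw [evolutionCLM_shiftPhases]
    refine (lintegral_cayley_rpow_le (norm_evolutionCLM_le C ω)
      (fun w hw => norm_one_sub_coordProj_add_le _ hw) (inner_coordProj hφ) hζ ht0 ht1).trans ?_
    refine ENNReal.ofReal_le_ofReal (mul_le_mul_of_nonneg_left ?_ Real.two_pi_pos.le)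
    refine div_le_div_of_nonneg_right ?_ hcos.le
    refine Real.rpow_le_rpow (by positivity) ?_ ht0.le
    nlinarith [norm_nonneg φ]

theorem exists_ne_dirSite (i : Dir d × Site d) : ∃ j : Dir d × Site d, i ≠ j := by
  refine ⟨((i.1.1, -i.1.2), i.2), fun h => ?_⟩
  have h2 := congrArg (fun k : Dir d × Site d => k.1.2) h
  exact units_ne_neg_self i.1.2 h2

theorem norm_inner_le_of_polarization (T : Hilb d →ₗ[ℂ] Hilb d) (x y : Hilb d) :
    ‖inner ℂ x (T y)‖ ≤ ‖inner ℂ (x + y) (T (x + y))‖ + ‖inner ℂ (x - y) (T (x - y))‖ +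
      ‖inner ℂ (x + Complex.I • y) (T (x + Complex.I • y))‖ +
      ‖inner ℂ (x - Complex.I • y) (T (x - Complex.I • y))‖ := by
  have h := inner_map_polarization T x y
  simp only [norm_inner_symm (𝕜 := ℂ) _ (T _)]
  rw [h, norm_div]
  have h1 : ∀ a b c e : ℂ, ‖a - b + Complex.I * c - Complex.I * e‖ ≤ ‖a‖ + ‖b‖ + ‖c‖ + ‖e‖ := by
    intro a b c e
    refine (norm_sub_le _ _).trans ?_
    refine add_le_add ((norm_add_le _ _).trans (add_le_add (norm_sub_le _ _) ?_)) ?_ <;> simp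
  refine (div_le_self (norm_nonneg _) (by norm_num)).trans (h1 _ _ _ _)

theorem exists_lintegral_neumannElement_le {μ : Measure Torus} [IsProbabilityMeasure μ]
    (hμ : HasBoundedDensity μ) {t : ℝ} (ht0 : 0 < t) (ht1 : t < 1) :
    ∃ K : NNReal, ∀ (C : Site d → Coin d) (ζ : ℂ), ‖ζ‖ < 1 → ∀ i j : Dir d × Site d,
      ∫⁻ ω, ENNReal.ofReal (‖neumannElement C ζ i j ω‖ ^ t) ∂(phaseLaw d μ) ≤ K := by
  obtain ⟨M, hM⟩ := hμ.exists_le_smul_volume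
  set B : ENNReal := M * (M * (ENNReal.ofReal (2 * Real.pi) *
        ENNReal.ofReal (2 * Real.pi * (5 ^ t / Real.cos (Real.pi / 2 * t))))) with hB
  have hBtop : B ≠ ⊤ := by
    rw [hB]
    exact ENNReal.mul_ne_top ENNReal.coe_ne_top (ENNReal.mul_ne_top ENNReal.coe_ne_top
      (ENNReal.mul_ne_top ENNReal.ofReal_ne_top ENNReal.ofReal_ne_top))
  have hKtop : B + B + B + B + 1 ≠ ⊤ := by
    simp [hBtop]
  refine ⟨(B + B + B + B + 1).toNNReal, fun C ζ hζ i j => ?_⟩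
  rw [ENNReal.coe_toNNReal hKtop]
  -- The shift argument needs two distinct indices; in the diagonal case an arbitrary second one is
  -- added.
  obtain ⟨l, hil, hjl⟩ : ∃ l, i ≠ l ∧ (j = i ∨ j = l) := by
    by_cases h : i = j
    · obtain ⟨l, hl⟩ := exists_ne_dirSite i
      exact ⟨l, hl, Or.inl h.symm⟩
    · exact ⟨j, h, Or.inr rfl⟩
  set x := ket i.1 i.2
  set y := ket j.1 j.2
  have hx : ‖x‖ = 1 := norm_ket _ _
  have hy : ‖y‖ = 1 := norm_ket _ _
  have hsupp : ∀ (c : ℂ) (k : Dir d × Site d), k ∉ ({i, l} : Finset (Dir d × Site d)) →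
      (x + c • y) k = 0 := by
    intro c k hk
    simp only [Finset.mem_insert, Finset.mem_singleton, not_or] at hk
    have h1 : k ≠ j := by
      rcases hjl with h | h
      · rw [h]; exact hk.1
      · rw [h]; exact hk.2
    change x k + c * y k = 0
    rw [ket_apply, ket_apply, if_neg hk.1, if_neg h1]
    simp
  have hnorm : ∀ c : ℂ, ‖c‖ = 1 → ‖x + c • y‖ ≤ 2 := by
    intro c hc
    refine (norm_add_le _ _).trans ?_
    rw [norm_smul, hc, hx, hy]
    norm_num
  set q : ℂ → Phases d → ENNReal := fun c ω => ENNReal.ofReal (‖inner ℂ (x + c • y)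
    ((2 : ℂ) • neumann (ζ • evolutionCLM C ω) (x + c • y) - (x + c • y))‖ ^ t) with hq
  have hqB : ∀ c : ℂ, ‖c‖ = 1 → ∫⁻ ω, q c ω ∂(phaseLaw d μ) ≤ B := fun c hc =>
    lintegral_phaseLaw_cayley_le hM ht0 ht1 C hζ hil (hsupp c) (hnorm c hc)
  have hqm : ∀ c : ℂ, Measurable (q c) := by
    intro c
    refine ENNReal.measurable_ofReal.comp (Measurable.pow_const (Measurable.norm ?_) t)
    simp_rw [inner_eq_sum_of_support (hsupp c)]
    refine Finset.measurable_fun_sum _ fun i _ => ?_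
    exact Measurable.const_inner
      (((measurable_neumann_apply C hζ (x + c • y) i).const_mul 2).sub measurable_const)
  have hpt : ∀ ω, ENNReal.ofReal (‖neumannElement C ζ i j ω‖ ^ t) ≤
      q 1 ω + q (-1) ω + q Complex.I ω + q (-Complex.I) ω + 1 := by
    intro ω
    set N := neumann (ζ • evolutionCLM C ω) with hN
    have h1 := norm_inner_le_of_polarization
      (((2 : ℂ) • N - 1 : Hilb d →L[ℂ] Hilb d) : Hilb d →ₗ[ℂ] Hilb d) x y
    have hT : ∀ v, (((2 : ℂ) • N - 1 : Hilb d →L[ℂ] Hilb d) : Hilb d →ₗ[ℂ] Hilb d) v =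
      (2 : ℂ) • N v - v := fun v => rfl
    simp only [hT] at h1
    rw [show x + y = x + (1 : ℂ) • y by rw [one_smul],
      show x - y = x + (-1 : ℂ) • y by rw [neg_smul, one_smul, sub_eq_add_neg],
      show x - Complex.I • y = x + (-Complex.I) • y by rw [neg_smul, sub_eq_add_neg]] at h1
    -- From `2 N = (2 N - 1) + 1`, where the identity contributes at most 1.
    have h2 : ‖neumannElement C ζ i j ω‖ ≤ ‖inner ℂ x ((2 : ℂ) • N y - y)‖ + 1 := by
      have h3 : (2 : ℂ) * neumannElement C ζ i j ω =
          inner ℂ x ((2 : ℂ) • N y - y) + inner ℂ x y := by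
        rw [inner_sub_right, inner_smul_right, sub_add_cancel]
        rfl
      have h4 : ‖inner ℂ x y‖ ≤ 1 := by
        simpa [hx, hy] using norm_inner_le_norm (𝕜 := ℂ) x y
      have h5 := congrArg norm h3
      rw [norm_mul, Complex.norm_ofNat] at h5
      have h6 := norm_add_le (inner ℂ x ((2 : ℂ) • N y - y)) (inner ℂ x y)
      linarith [norm_nonneg (neumannElement C ζ i j ω)]
    have hsub : ∀ a b : ℝ, 0 ≤ a → 0 ≤ b → ENNReal.ofReal ((a + b) ^ t) ≤
        ENNReal.ofReal (a ^ t) + ENNReal.ofReal (b ^ t) := by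
      intro a b ha hb
      rw [← ENNReal.ofReal_add (by positivity) (by positivity)]
      exact ENNReal.ofReal_le_ofReal (Real.rpow_add_le_add_rpow ha hb ht0.le ht1.le)
    have h7 := h2.trans (add_le_add_left h1 1)
    refine (ENNReal.ofReal_le_ofReal (Real.rpow_le_rpow (norm_nonneg _) h7 ht0.le)).trans ?_
    refine (hsub _ _ (by positivity) zero_le_one).trans (add_le_add ?_ (by simp))
    refine (hsub _ _ (by positivity) (by positivity)).trans (add_le_add ?_ ?_)
    · refine (hsub _ _ (by positivity) (by positivity)).trans (add_le_add ?_ ?_)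
      · exact hsub _ _ (by positivity) (by positivity)
      · exact le_rfl
    · exact le_rfl
  refine (lintegral_mono hpt).trans ?_
  rw [lintegral_add_right _ measurable_const, lintegral_add_right _ (hqm _),
    lintegral_add_right _ (hqm _), lintegral_add_right _ (hqm _), lintegral_const]
  have : phaseLaw d μ Set.univ = 1 := by
    rw [phaseLaw]
    exact measure_univ
  rw [this, one_mul]
  exact add_le_add (add_le_add (add_le_add (add_le_add (hqB _ (by simp)) (hqB _ (by simp)))
    (hqB _ (by simp))) (hqB _ (by simp))) le_rfl

end Moments

/-! ### The Green function -/

section Green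

variable {d : ℕ}

/-- The Green function `⟨i| (𝔻(ω) 𝕊(𝒞) - z)⁻¹ |j⟩`, expressed by Neumann series. -/
def green (C : Site d → Coin d) (z : ℂ) (i j : Dir d × Site d) (ω : Phases d) : ℂ :=
  if 1 < ‖z‖ then -z⁻¹ * neumannElement C z⁻¹ i j ω
  else inner ℂ (evolution C ω (neumann (starRingEnd ℂ z • evolutionCLM C ω) (ket i.1 i.2)))
    (ket j.1 j.2)

theorem norm_inv_lt_one {z : ℂ} (hz : 1 < ‖z‖) : ‖z⁻¹‖ < 1 := by
  rw [norm_inv]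
  exact inv_lt_one_of_one_lt₀ hz

/-- Makes `green` independent of how a solution of `(U - z) v = |j⟩` was found. For `‖z‖ < 1` the
isometry is moved to the other side: if `y - z̄ U y = |i⟩`, then `⟪i, v⟫ = ⟪U y, (U - z) v⟫`.
Surjectivity of `U` is not needed. -/
theorem apply_eq_green {C : Site d → Coin d} {ω : Phases d} {z : ℂ} (hz : ‖z‖ ≠ 1)
    {j : Dir d × Site d} {v : Hilb d} (hv : evolution C ω v - z • v = ket j.1 j.2)
    (i : Dir d × Site d) : v i = green C z i j ω := by
  rw [green]
  split_ifs with h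
  · have hz0 : z ≠ 0 := by
      rintro rfl
      simp at h
      linarith
    have h1 := neumann_apply_sub (norm_smul_evolutionCLM_lt C ω (norm_inv_lt_one h)) v
    have h2 : v - (z⁻¹ • evolutionCLM C ω) v = -z⁻¹ • ket j.1 j.2 := by
      rw [← hv, smul_sub, smul_smul, neg_mul, inv_mul_cancel₀ hz0, neg_smul, neg_smul, one_smul,
        sub_neg_eq_add, neg_add_eq_sub]
      rfl
    rw [h2, map_smul] at h1
    rw [← h1, neumannElement, inner_ket]
    rfl
  · have hlt : ‖starRingEnd ℂ z‖ < 1 := by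
      rw [Complex.norm_conj]
      exact lt_of_le_of_ne (not_lt.1 h) hz
    have h1 := neumann_sub_apply (norm_smul_evolutionCLM_lt C ω hlt) (ket i.1 i.2)
    set y := neumann (starRingEnd ℂ z • evolutionCLM C ω) (ket i.1 i.2)
    have h2 : y - starRingEnd ℂ z • evolution C ω y = ket i.1 i.2 := h1
    rw [← inner_ket i.1 i.2 v, ← h2, ← hv, inner_sub_left, inner_sub_right, inner_smul_left,
      inner_smul_right, (evolution C ω).inner_map_map, Complex.conj_conj]

theorem measurable_green (C : Site d → Coin d) {z : ℂ} (hz : ‖z‖ ≠ 1) (i j : Dir d × Site d) :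
    Measurable (green C z i j) := by
  unfold green
  split_ifs with h
  · exact (measurable_neumannElement C (norm_inv_lt_one h) i j).const_mul _
  · have hlt : ‖starRingEnd ℂ z‖ < 1 := by
      rw [Complex.norm_conj]
      exact lt_of_le_of_ne (not_lt.1 h) hz
    simp_rw [← inner_conj_symm _ (ket j.1 j.2), inner_ket]
    exact (Complex.continuous_conj.measurable).comp
      (measurable_evolution_apply C (measurable_neumann_apply C hlt _) _)

theorem exists_norm_green_le {z : ℂ} (hz : ‖z‖ ≠ 1) (C : Site d → Coin d)
    (i j : Dir d × Site d) : ∃ ζ : ℂ, ‖ζ‖ < 1 ∧ ∃ k l : Dir d × Site d, ∀ ω,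
      ‖green C z i j ω‖ ≤ 2 * (‖neumannElement C ζ k l ω‖ + 1) := by
  by_cases h : 1 < ‖z‖
  · refine ⟨z⁻¹, norm_inv_lt_one h, i, j, fun ω => ?_⟩
    rw [green, if_pos h, norm_mul, norm_neg]
    nlinarith [norm_inv_lt_one h, norm_nonneg z⁻¹, norm_nonneg (neumannElement C z⁻¹ i j ω)]
  · have hlt : ‖starRingEnd ℂ z‖ < 1 := by
      rw [Complex.norm_conj]
      exact lt_of_le_of_ne (not_lt.1 h) hz
    refine ⟨starRingEnd ℂ z, hlt, j, i, fun ω => ?_⟩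
    rw [green, if_neg h, neumannElement]
    have h1 := neumann_sub_apply (norm_smul_evolutionCLM_lt C ω hlt) (ket i.1 i.2)
    set y := neumann (starRingEnd ℂ z • evolutionCLM C ω) (ket i.1 i.2)
    have h2 : y - starRingEnd ℂ z • evolution C ω y = ket i.1 i.2 := h1
    rw [Complex.norm_conj] at hlt
    -- For small `z` the Neumann series gives the deterministic bound `‖y‖ ≤ 2`; otherwise `z ⟪U y,
    -- j⟫ = ⟪y, j⟫ - ⟪i, j⟫` may be divided by `z` at a cost of at most 2.
    rcases le_or_gt ‖z‖ (1 / 2) with hz2 | hz2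
    · have h3 : ‖y‖ ≤ 2 := by
        have h4 : ‖y‖ ≤ 1 + ‖z‖ * ‖y‖ := by
          calc ‖y‖ = ‖ket i.1 i.2 + starRingEnd ℂ z • evolution C ω y‖ := by
                rw [← h2, sub_add_cancel]
            _ ≤ _ := by
                refine (norm_add_le _ _).trans ?_
                rw [norm_ket, norm_smul, Complex.norm_conj, (evolution C ω).norm_map]
        nlinarith [norm_nonneg y]
      have h5 := norm_inner_le_norm (𝕜 := ℂ) (evolution C ω y) (ket j.1 j.2)
      rw [(evolution C ω).norm_map, norm_ket, mul_one] at h5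
      linarith [norm_nonneg (inner ℂ (ket j.1 j.2) y)]
    · have h3 : z * inner ℂ (evolution C ω y) (ket j.1 j.2) =
          inner ℂ y (ket j.1 j.2) - inner ℂ (ket i.1 i.2) (ket j.1 j.2) := by
        rw [← h2, inner_sub_left, inner_smul_left, Complex.conj_conj]
        ring
      have h4 := congrArg norm h3
      rw [norm_mul] at h4
      have h5 := norm_sub_le (inner ℂ y (ket j.1 j.2)) (inner ℂ (ket i.1 i.2) (ket j.1 j.2))
      have h6 := norm_inner_le_norm (𝕜 := ℂ) (ket i.1 i.2) (ket j.1 j.2)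
      rw [norm_ket, norm_ket, mul_one] at h6
      rw [norm_inner_symm y] at h5
      nlinarith [norm_nonneg (inner ℂ (evolution C ω y) (ket j.1 j.2))]

/-- The a priori bound on the fractional moments of the Green function. -/
theorem exists_lintegral_green_le {μ : Measure Torus} [IsProbabilityMeasure μ]
    (hμ : HasBoundedDensity μ) {t : ℝ} (ht0 : 0 < t) (ht1 : t < 1) :
    ∃ K : NNReal, ∀ (C : Site d → Coin d) (z : ℂ), ‖z‖ ≠ 1 → ∀ i j : Dir d × Site d,
      ∫⁻ ω, ENNReal.ofReal (‖green C z i j ω‖ ^ t) ∂(phaseLaw d μ) ≤ K := by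
  obtain ⟨K, hK⟩ := exists_lintegral_neumannElement_le (d := d) hμ ht0 ht1
  refine ⟨2 * (K + 1), fun C z hz i j => ?_⟩
  obtain ⟨ζ, hζ, k, l, hkl⟩ := exists_norm_green_le hz C i j
  have h2 : (2 : ℝ) ^ t ≤ 2 := by
    conv_rhs => rw [← Real.rpow_one 2]
    exact Real.rpow_le_rpow_of_exponent_le (by norm_num) ht1.le
  have hpt : ∀ ω, ENNReal.ofReal (‖green C z i j ω‖ ^ t) ≤
      2 * (ENNReal.ofReal (‖neumannElement C ζ k l ω‖ ^ t) + 1) := by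
    intro ω
    have h1 : ‖green C z i j ω‖ ^ t ≤ 2 * (‖neumannElement C ζ k l ω‖ ^ t + 1) := by
      refine (Real.rpow_le_rpow (norm_nonneg _) (hkl ω) ht0.le).trans ?_
      rw [Real.mul_rpow (by norm_num) (by positivity)]
      refine mul_le_mul h2 ?_ (by positivity) (by norm_num)
      simpa using Real.rpow_add_le_add_rpow (norm_nonneg (neumannElement C ζ k l ω))
        zero_le_one ht0.le ht1.le
    refine (ENNReal.ofReal_le_ofReal h1).trans ?_
    rw [ENNReal.ofReal_mul (by norm_num), ENNReal.ofReal_add (by positivity) zero_le_one]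
    simp
  refine (lintegral_mono hpt).trans ?_
  have hP : phaseLaw d μ Set.univ = 1 := by
    rw [phaseLaw]
    exact measure_univ
  rw [lintegral_const_mul' _ _ (by norm_num), lintegral_add_right _ measurable_const,
    lintegral_const, hP, one_mul]
  push_cast
  gcongr
  exact hK C ζ hζ k l

end Green

/-! ### Restrictions of the evolution to finite dimensional invariant subspaces -/

section Restrict

variable {d : ℕ}

theorem eq_zero_of_evolution_eq_smul {C : Site d → Coin d} {ω : Phases d} {z : ℂ} (hz : ‖z‖ ≠ 1)
    {v : Hilb d} (hv : evolution C ω v - z • v = 0) : v = 0 := by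
  have h := congrArg norm (sub_eq_zero.1 hv)
  rw [(evolution C ω).norm_map, norm_smul] at h
  by_contra h0
  exact hz (mul_right_cancel₀ (norm_ne_zero_iff.2 h0) (by rw [one_mul, ← h]))

/-- An isometry has no eigenvalue off the unit circle, and in finite dimension injectivity suffices.
-/
theorem isUnit_restrict_sub_smul {C : Site d → Coin d} {ω : Phases d} {z : ℂ} (hz : ‖z‖ ≠ 1)
    {K : Submodule ℂ (Hilb d)} [FiniteDimensional ℂ K] {T : Module.End ℂ K}
    (hT : ∀ v : K, (T v : Hilb d) = evolution C ω v) :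
    IsUnit (T - z • (1 : Module.End ℂ K)) := by
  rw [LinearMap.isUnit_iff_ker_eq_bot, LinearMap.ker_eq_bot']
  intro v hv
  have h := congrArg (fun w : K => (w : Hilb d)) hv
  simp only [LinearMap.sub_apply, LinearMap.smul_apply, Module.End.one_apply,
    Submodule.coe_sub, Submodule.coe_smul, hT, Submodule.coe_zero] at h
  exact Subtype.ext (eq_zero_of_evolution_eq_smul hz h)

theorem exists_evolution_sub_smul_eq {C : Site d → Coin d} {ω : Phases d} {z : ℂ} (hz : ‖z‖ ≠ 1)
    {K : Submodule ℂ (Hilb d)} [FiniteDimensional ℂ K] (hK : ∀ v ∈ K, evolution C ω v ∈ K)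
    {φ : Hilb d} (hφ : φ ∈ K) : ∃ v : Hilb d, evolution C ω v - z • v = φ := by
  have hu := isUnit_restrict_sub_smul (C := C) (ω := ω) hz
    (T := (evolution C ω).toLinearMap.restrict hK) fun v => rfl
  refine ⟨(Ring.inverse ((evolution C ω).toLinearMap.restrict hK - z • (1 : Module.End ℂ K))
    ⟨φ, hφ⟩ : K), ?_⟩
  have h := congrArg (fun A : Module.End ℂ K => ((A ⟨φ, hφ⟩ : K) : Hilb d))
    (Ring.mul_inverse_cancel _ hu)
  exact h

instance finiteDimensional_boxSpace (π : Equiv.Perm (Dir d)) (L : ℕ) :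
    FiniteDimensional ℂ (boxSpace π L) := by
  have hfin : {x : Site d | boxNorm x ≤ L}.Finite := by
    refine (Set.Finite.pi' fun _ : Fin d => Set.finite_Icc (-(L : ℤ)) L).subset fun x hx i => ?_
    have h : (x i).natAbs ≤ L :=
      (Finset.le_sup (f := fun i => (x i).natAbs) (Finset.mem_univ i)).trans hx
    rw [Set.mem_Icc]
    omega
  have h : boxSpace π L =
      ⨆ x : {x : Site d | boxNorm x ≤ L}, ⨆ τ : Dir d, cycleSpace π τ x := by
    rw [boxSpace, iSup_subtype]
    rfl
  have := hfin.to_subtype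
  have h2 : ∀ (τ : Dir d) (x : Site d), FiniteDimensional ℂ (cycleSpace π τ x) := fun τ x =>
    FiniteDimensional.span_of_finite ℂ ((Set.finite_Iio _).image _)
  rw [h]
  infer_instance

theorem isUnit_boxWalk_sub_smul {π : Equiv.Perm (Dir d)} (hπ : NoDrift π) (C : Coin d) (L : ℕ)
    (ω : Phases d) {z : ℂ} (hz : ‖z‖ ≠ 1) :
    IsUnit (boxWalk hπ C L ω - z • (1 : Module.End ℂ (boxSpace π L))) :=
  isUnit_restrict_sub_smul (C := boxCoins π C L) (ω := ω) hz fun _ => rfl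

theorem evolution_boxResolvent {π : Equiv.Perm (Dir d)} (hπ : NoDrift π) (C : Coin d) (L : ℕ)
    (ω : Phases d) {z : ℂ} (hz : ‖z‖ ≠ 1) (ψ : boxSpace π L) :
    evolution (boxCoins π C L) ω (boxResolvent hπ C L ω z ψ : Hilb d) -
      z • (boxResolvent hπ C L ω z ψ : Hilb d) = ψ :=
  congrArg (fun A : Module.End ℂ (boxSpace π L) => ((A ψ : boxSpace π L) : Hilb d))
    (Ring.mul_inverse_cancel _ (isUnit_boxWalk_sub_smul hπ C L ω hz))

theorem resolventElement_eq_green {π : Equiv.Perm (Dir d)} (hπ : NoDrift π) (C : Coin d) (L : ℕ)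
    (ω : Phases d) {z : ℂ} (hz : ‖z‖ ≠ 1) {τ σ : Dir d} {x y : Site d}
    (hx : ket τ x ∈ boxSpace π L) (hy : ket σ y ∈ boxSpace π L) :
    resolventElement hπ C L ω z ⟨ket τ x, hx⟩ ⟨ket σ y, hy⟩ =
      green (boxCoins π C L) z (τ, x) (σ, y) ω := by
  rw [resolventElement, inner_ket]
  exact apply_eq_green hz (j := (σ, y)) (evolution_boxResolvent hπ C L ω hz ⟨ket σ y, hy⟩) _

end Restrict

/-! ### The decoupled walk with coin `C_π` -/

section Decoupled

variable {d : ℕ}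

/-- The permutation of the basis labels induced by the walk with coin `C_π`. -/
def permStep (π : Equiv.Perm (Dir d)) (i : Dir d × Site d) : Dir d × Site d :=
  (π i.1, i.2 + r (π i.1))

theorem permStep_injective (π : Equiv.Perm (Dir d)) : Function.Injective (permStep π) := by
  rintro ⟨τ, x⟩ ⟨σ, y⟩ h
  simp only [permStep, Prod.mk.injEq] at h
  have h1 := π.injective h.1
  subst h1
  simpa using h.2

theorem permStep_symm (π : Equiv.Perm (Dir d)) (i : Dir d × Site d) :
    permStep π (π.symm i.1, i.2 - r i.1) = i := by
  simp [permStep]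

/-- The labels of the basis vectors spanning `ℋ_x^τ`. -/
def cycleLabels (π : Equiv.Perm (Dir d)) (τ : Dir d) (x : Site d) : Finset (Dir d × Site d) :=
  (Finset.range (Function.minimalPeriod π τ)).image fun t =>
    ((π ^ t) τ, x + ∑ s ∈ Finset.range (t + 1), r ((π ^ s) τ))

theorem mem_cycleLabels_self (π : Equiv.Perm (Dir d)) (τ : Dir d) (x : Site d) :
    (τ, x) ∈ cycleLabels π τ (x - r τ) :=
  Finset.mem_image.2 ⟨0, Finset.mem_range.2 (minimalPeriod_pos π τ), by simp⟩

theorem permStep_mem_cycleLabels {π : Equiv.Perm (Dir d)} (hπ : NoDrift π) {τ : Dir d}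
    {x : Site d} {i : Dir d × Site d} (hi : i ∈ cycleLabels π τ x) :
    permStep π i ∈ cycleLabels π τ x := by
  obtain ⟨t, ht, rfl⟩ := Finset.mem_image.1 hi
  rw [Finset.mem_range] at ht
  have hstep : permStep π ((π ^ t) τ, x + ∑ s ∈ Finset.range (t + 1), r ((π ^ s) τ)) =
      ((π ^ (t + 1)) τ, x + ∑ s ∈ Finset.range (t + 1 + 1), r ((π ^ s) τ)) := by
    rw [permStep, Finset.sum_range_succ _ (t + 1), pow_succ', Equiv.Perm.mul_apply, add_assoc]
  rw [hstep, cycleLabels, Finset.mem_image]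
  rcases Nat.lt_or_ge (t + 1) (Function.minimalPeriod π τ) with h | h
  · exact ⟨t + 1, Finset.mem_range.2 h, rfl⟩
  · have hm : t + 1 = Function.minimalPeriod π τ := by omega
    refine ⟨0, Finset.mem_range.2 (minimalPeriod_pos π τ), ?_⟩
    rw [hm, Finset.sum_range_succ _ (Function.minimalPeriod π τ), hπ τ, pow_minimalPeriod]
    simp

/-- An injective map of a finite set into itself is onto; hence the complement of a block is
preserved too. -/
theorem permStep_mem_cycleLabels_iff {π : Equiv.Perm (Dir d)} (hπ : NoDrift π) {τ : Dir d}
    {x : Site d} {i : Dir d × Site d} :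
    permStep π i ∈ cycleLabels π τ x ↔ i ∈ cycleLabels π τ x := by
  refine ⟨fun h => ?_, permStep_mem_cycleLabels hπ⟩
  have himg : (cycleLabels π τ x).image (permStep π) = cycleLabels π τ x := by
    refine Finset.eq_of_subset_of_card_le
      (Finset.image_subset_iff.2 fun k hk => permStep_mem_cycleLabels hπ hk) ?_
    rw [Finset.card_image_of_injective _ (permStep_injective π)]
  rw [← himg] at h
  obtain ⟨k, hk, hki⟩ := Finset.mem_image.1 h
  rwa [← permStep_injective π hki]

/-- The source of the threshold 2: the step `r τ` back to the base point and a partial sum along the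
cycle each have norm at most 1. -/
theorem boxNorm_sub_le_of_mem_cycleLabels {π : Equiv.Perm (Dir d)} {τ σ : Dir d} {x y : Site d}
    (h : (σ, y) ∈ cycleLabels π τ (x - r τ)) : boxNorm (x - y) ≤ 2 := by
  obtain ⟨t, ht, hty⟩ := Finset.mem_image.1 h
  have hy : x - r τ + ∑ s ∈ Finset.range (t + 1), r ((π ^ s) τ) = y := (Prod.mk.inj hty).2
  have h1 := boxNorm_path_le π τ 0 (Finset.mem_range.1 ht)
  refine Finset.sup_le fun i _ => ?_
  have h2 : ((0 + ∑ s ∈ Finset.range (t + 1), r ((π ^ s) τ) : Site d) i).natAbs ≤ 1 :=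
    (Finset.le_sup (f := fun i => ((0 + ∑ s ∈ Finset.range (t + 1), r ((π ^ s) τ) : Site d)
      i).natAbs) (Finset.mem_univ i)).trans (h1.trans (by simp [boxNorm]))
  have h3 : (r τ i).natAbs ≤ 1 := by
    simpa using natAbs_sum_r_le {τ} i
  rw [← hy]
  simp only [Pi.sub_apply, Pi.add_apply, Pi.zero_apply] at h2 ⊢
  omega

theorem evolution_permCoin_apply (π : Equiv.Perm (Dir d)) (ω : Phases d) (ψ : Hilb d)
    (i : Dir d × Site d) : evolution (fun _ => permCoin π) ω ψ i =
      phase (ω i) * ψ (π.symm i.1, i.2 - r i.1) := by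
  rw [evolution_apply]
  congr 1
  rw [Finset.sum_eq_single (π.symm i.1)]
  · simp [permCoin]
  · intro σ _ hσ
    have : i.1 ≠ π σ := fun h => hσ (by rw [h, Equiv.symm_apply_apply])
    simp [permCoin, this]
  · simp

theorem evolution_permCoin_coordProj {π : Equiv.Perm (Dir d)} (hπ : NoDrift π) (τ : Dir d)
    (x : Site d) (ω : Phases d) (ψ : Hilb d) :
    evolution (fun _ => permCoin π) ω (coordProj (cycleLabels π τ x) ψ) =
      coordProj (cycleLabels π τ x) (evolution (fun _ => permCoin π) ω ψ) := by
  ext i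
  have h := permStep_mem_cycleLabels_iff hπ (τ := τ) (x := x) (i := (π.symm i.1, i.2 - r i.1))
  rw [permStep_symm] at h
  rw [evolution_permCoin_apply, coordProj_apply, coordProj_apply, evolution_permCoin_apply]
  simp only [h]
  split_ifs <;> simp

theorem evolution_permCoin_ket (π : Equiv.Perm (Dir d)) (ω : Phases d) (i : Dir d × Site d) :
    evolution (fun _ => permCoin π) ω (ket i.1 i.2) =
      phase (ω (permStep π i)) • ket (permStep π i).1 (permStep π i).2 := by
  change diag ω (walk (fun _ => permCoin π) (ket i.1 i.2)) = _
  rw [walk_permCoin_ket π _ _ _ rfl, diag_ket]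
  rfl

theorem exists_evolution_permCoin_sub_smul_eq {π : Equiv.Perm (Dir d)} (hπ : NoDrift π)
    (ω : Phases d) {z : ℂ} (hz : ‖z‖ ≠ 1) {τ : Dir d} {x : Site d} {k : Dir d × Site d}
    (hk : k ∈ cycleLabels π τ x) :
    ∃ v : Hilb d, evolution (fun _ => permCoin π) ω v - z • v = ket k.1 k.2 := by
  set S : Set (Hilb d) := (fun i : Dir d × Site d => ket i.1 i.2) '' (cycleLabels π τ x) with hS
  have : FiniteDimensional ℂ (Submodule.span ℂ S) :=
    FiniteDimensional.span_of_finite ℂ ((Finset.finite_toSet _).image _)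
  refine exists_evolution_sub_smul_eq (K := Submodule.span ℂ S) hz ?_
    (Submodule.subset_span ⟨k, hk, rfl⟩)
  suffices h : Submodule.span ℂ S ≤ (Submodule.span ℂ S).comap
      (evolution (fun _ => permCoin π) ω).toLinearMap from fun v hv => h hv
  rw [Submodule.span_le]
  rintro _ ⟨i, hi, rfl⟩
  change evolution (fun _ => permCoin π) ω (ket i.1 i.2) ∈ Submodule.span ℂ S
  rw [evolution_permCoin_ket]
  exact Submodule.smul_mem _ _
    (Submodule.subset_span ⟨permStep π i, permStep_mem_cycleLabels hπ hi, rfl⟩)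

/-- The resolvent identity, with the walk with coin `C_π` as the unperturbed one. -/
theorem green_eq_sum {π : Equiv.Perm (Dir d)} (hπ : NoDrift π) {C : Site d → Coin d}
    {ω : Phases d} {z : ℂ} (hz : ‖z‖ ≠ 1) {τ : Dir d} {x : Site d} {i j : Dir d × Site d}
    (hi : i ∈ cycleLabels π τ x) (hj : j ∉ cycleLabels π τ x) {v : Hilb d}
    (hv : evolution C ω v - z • v = ket j.1 j.2) :
    green C z i j ω = ∑ k ∈ cycleLabels π τ x, green (fun _ => permCoin π) z i k ω *
      (phase (ω k) * ∑ σ, ((permCoin π : Matrix (Dir d) (Dir d) ℂ) -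
        (C (k.2 - r k.1) : Matrix (Dir d) (Dir d) ℂ)) k.1 σ *
          green C z (σ, k.2 - r k.1) j ω) := by
  set O := cycleLabels π τ x with hO
  set V := evolution (fun _ : Site d => permCoin π) ω with hV
  set w : Hilb d := V v - evolution C ω v with hw
  have hwk : ∀ k, w k = phase (ω k) * ∑ σ, ((permCoin π : Matrix (Dir d) (Dir d) ℂ) -
        (C (k.2 - r k.1) : Matrix (Dir d) (Dir d) ℂ)) k.1 σ *
          green C z (σ, k.2 - r k.1) j ω := by
    intro k
    change V v k - evolution C ω v k = _
    rw [hV, evolution_apply, evolution_apply, ← mul_sub, ← Finset.sum_sub_distrib]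
    congr 1
    refine Finset.sum_congr rfl fun σ _ => ?_
    rw [apply_eq_green hz hv, Matrix.sub_apply, sub_mul]
  have hex : ∀ k : Dir d × Site d, ∃ u : Hilb d, k ∈ O → V u - z • u = ket k.1 k.2 := by
    intro k
    by_cases hk : k ∈ O
    · obtain ⟨u, hu⟩ := exists_evolution_permCoin_sub_smul_eq hπ ω hz hk
      exact ⟨u, fun _ => hu⟩
    · exact ⟨0, fun h => absurd h hk⟩
  choose u hu using hex
  have h1 : V (∑ k ∈ O, w k • u k) - z • ∑ k ∈ O, w k • u k = coordProj O w := by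
    rw [coordProj_eq_sum, map_sum, Finset.smul_sum, ← Finset.sum_sub_distrib]
    refine Finset.sum_congr rfl fun k hk => ?_
    rw [← hu k hk, map_smul, smul_sub, smul_comm]
  -- Since `(V - z) v = |j⟩ + w`, projecting to the block, which commutes with `V`, removes `|j⟩`.
  have h2 : V (coordProj O v) - z • coordProj O v = coordProj O w := by
    have h3 : w = (V v - z • v) - ket j.1 j.2 := by
      rw [← hv, hw]
      abel
    have h4 : coordProj O (ket j.1 j.2) = 0 := by
      rw [coordProj_eq_sum]
      refine Finset.sum_eq_zero fun k hk => ?_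
      rw [ket_apply, if_neg (ne_of_mem_of_not_mem hk hj), zero_smul]
    rw [h3, map_sub, map_sub, map_smul, h4, sub_zero, hV, hO, evolution_permCoin_coordProj hπ]
  -- Injectivity of `V - z` identifies the two solutions; its invertibility on the whole space is
  -- never used.
  have h5 : coordProj O v - ∑ k ∈ O, w k • u k = 0 := by
    refine eq_zero_of_evolution_eq_smul (C := fun _ => permCoin π) (ω := ω) hz ?_
    rw [map_sub, smul_sub, sub_sub_sub_comm, ← hV, h1, h2, sub_self]
  have h6 := congrArg (fun ψ : Hilb d => ψ i) (sub_eq_zero.1 h5)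
  simp only [coordProj_apply, if_pos hi, lp.coeFn_sum, Finset.sum_apply] at h6
  rw [← apply_eq_green hz hv, h6]
  refine Finset.sum_congr rfl fun k hk => ?_
  rw [← hwk, ← apply_eq_green hz (hu k hk), mul_comm]
  rfl

theorem norm_apply_le_opNorm (A : Matrix (Dir d) (Dir d) ℂ) (τ σ : Dir d) :
    ‖A τ σ‖ ≤ opNorm A := by
  have h1 := PiLp.norm_apply_le
    (Matrix.toEuclideanCLM (𝕜 := ℂ) A (EuclideanSpace.single σ (1 : ℂ))) τ
  have h2 := (Matrix.toEuclideanCLM (𝕜 := ℂ) A).le_opNorm (EuclideanSpace.single σ (1 : ℂ))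
  have h3 : (Matrix.toEuclideanCLM (𝕜 := ℂ) A (EuclideanSpace.single σ (1 : ℂ))) τ = A τ σ := by
    simp [Matrix.ofLp_toEuclideanCLM]
  rw [h3] at h1
  exact h1.trans (h2.trans (by simp [opNorm]))

theorem opNorm_nonneg (A : Matrix (Dir d) (Dir d) ℂ) : 0 ≤ opNorm A := norm_nonneg _

theorem norm_permCoin_sub_boxCoins_le (π : Equiv.Perm (Dir d)) (C : Coin d) (L : ℕ) (y : Site d)
    (τ σ : Dir d) : ‖((permCoin π : Matrix (Dir d) (Dir d) ℂ) -
      (boxCoins π C L y : Matrix (Dir d) (Dir d) ℂ)) τ σ‖ ≤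
      opNorm ((C : Matrix (Dir d) (Dir d) ℂ) - (permCoin π : Matrix (Dir d) (Dir d) ℂ)) := by
  rw [boxCoins]
  split_ifs
  · rw [sub_self]
    simpa using opNorm_nonneg _
  · refine le_trans (le_of_eq ?_) (norm_apply_le_opNorm _ τ σ)
    rw [Matrix.sub_apply, Matrix.sub_apply, norm_sub_rev]

/-- At boundary sites the coin already is `C_π`, so the perturbation vanishes there and elsewhere
its entries are at most `‖C - C_π‖`. -/
theorem norm_green_le_sum {π : Equiv.Perm (Dir d)} (hπ : NoDrift π) (C : Coin d) (L : ℕ)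
    (ω : Phases d) {z : ℂ} (hz : ‖z‖ ≠ 1) {τ σ : Dir d} {x y : Site d}
    (hy : ket σ y ∈ boxSpace π L) (hxy : 2 < boxNorm (x - y)) :
    ‖green (boxCoins π C L) z (τ, x) (σ, y) ω‖ ≤
      opNorm ((C : Matrix (Dir d) (Dir d) ℂ) - (permCoin π : Matrix (Dir d) (Dir d) ℂ)) *
        ∑ q ∈ cycleLabels π τ (x - r τ) ×ˢ (Finset.univ : Finset (Dir d)),
          ‖green (fun _ => permCoin π) z (τ, x) q.1 ω‖ *
            ‖green (boxCoins π C L) z (q.2, q.1.2 - r q.1.1) (σ, y) ω‖ := by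
  have hj : (σ, y) ∉ cycleLabels π τ (x - r τ) := fun h =>
    absurd (boxNorm_sub_le_of_mem_cycleLabels h) (by omega)
  rw [green_eq_sum hπ hz (mem_cycleLabels_self π τ x) hj
    (evolution_boxResolvent hπ C L ω hz ⟨ket σ y, hy⟩), Finset.sum_product, Finset.mul_sum]
  refine (norm_sum_le _ _).trans (Finset.sum_le_sum fun k _ => ?_)
  rw [norm_mul, norm_mul, norm_phase, one_mul]
  refine (mul_le_mul_of_nonneg_left (norm_sum_le _ _) (norm_nonneg _)).trans ?_
  rw [Finset.mul_sum, Finset.mul_sum]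
  refine Finset.sum_le_sum fun ρ _ => ?_
  rw [norm_mul, mul_left_comm]
  exact mul_le_mul_of_nonneg_right (norm_permCoin_sub_boxCoins_le π C L _ _ _)
    (mul_nonneg (norm_nonneg _) (norm_nonneg _))

end Decoupled

/-! ### Interpolation of fractional moments -/

section Interpolation

theorem rpow_mul_rpow_mul_rpow_le {x a b u q : ℝ} (hx : 0 ≤ x) (ha : 0 ≤ a) (hb : 0 ≤ b)
    (hu : 0 ≤ u) (hq : 0 ≤ q) :
    x ^ u * (a ^ q * b ^ q) ≤ x ^ (u + (q + q)) + a ^ (u + (q + q)) + b ^ (u + (q + q)) := by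
  set m := max x (max a b) with hm
  have hm0 : 0 ≤ m := hx.trans (le_max_left _ _)
  have h1 : x ^ u * (a ^ q * b ^ q) ≤ m ^ u * (m ^ q * m ^ q) := by
    gcongr
    · exact le_max_left _ _
    · exact (le_max_left _ _).trans (le_max_right _ _)
    · exact (le_max_right _ _).trans (le_max_right _ _)
  rw [← Real.rpow_add_of_nonneg hm0 hq hq, ← Real.rpow_add_of_nonneg hm0 hu (by linarith)] at h1
  refine h1.trans ?_
  have hx' : 0 ≤ x ^ (u + (q + q)) := by positivity
  have ha' : 0 ≤ a ^ (u + (q + q)) := by positivity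
  have hb' : 0 ≤ b ^ (u + (q + q)) := by positivity
  rcases max_choice x (max a b) with h | h
  · rw [hm, h]
    linarith
  · rcases max_choice a b with h2 | h2
    · rw [hm, h, h2]
      linarith
    · rw [hm, h, h2]
      linarith

theorem sum_rpow_le_sum_rpow {ι : Type*} (A : Finset ι) {f : ι → ℝ} (hf : ∀ i, 0 ≤ f i) {q : ℝ}
    (hq0 : 0 < q) (hq1 : q ≤ 1) : (∑ i ∈ A, f i) ^ q ≤ ∑ i ∈ A, f i ^ q := by
  induction A using Finset.cons_induction with
  | empty => simp [hq0.ne']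
  | cons i A hi ih =>
    rw [Finset.sum_cons, Finset.sum_cons]
    exact (Real.rpow_add_le_add_rpow (hf i) (Finset.sum_nonneg fun k _ => hf k) hq0.le hq1).trans
      (add_le_add le_rfl ih)

/-- Only the factor `x ^ q` of `x ^ s = x ^ (s - q) * x ^ q` is expanded by the hypothesis. Each
resulting product has total degree `s + q` and is at most the `(s + q)`-th power of the largest
factor, so no Hölder inequality is needed. -/
theorem rpow_le_of_le_mul_sum {ι : Type*} (A : Finset ι) {a b : ι → ℝ} (ha : ∀ i, 0 ≤ a i)
    (hb : ∀ i, 0 ≤ b i) {x η s q : ℝ} (hx : 0 ≤ x) (hη : 0 ≤ η) (hq0 : 0 < q) (hq1 : q ≤ 1)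
    (hqs : q ≤ s) (h : x ≤ η * ∑ i ∈ A, a i * b i) :
    x ^ s ≤ η ^ q * ∑ i ∈ A, (x ^ (s + q) + a i ^ (s + q) + b i ^ (s + q)) := by
  have h1 : x ^ q ≤ η ^ q * ∑ i ∈ A, a i ^ q * b i ^ q := by
    refine (Real.rpow_le_rpow hx h hq0.le).trans ?_
    rw [Real.mul_rpow hη (Finset.sum_nonneg fun i _ => mul_nonneg (ha i) (hb i))]
    refine mul_le_mul_of_nonneg_left ?_ (by positivity)
    refine (sum_rpow_le_sum_rpow A (fun i => mul_nonneg (ha i) (hb i)) hq0 hq1).trans (le_of_eq ?_)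
    exact Finset.sum_congr rfl fun i _ => Real.mul_rpow (ha i) (hb i)
  have h2 : x ^ s = x ^ (s - q) * x ^ q := by
    rw [← Real.rpow_add_of_nonneg hx (by linarith) hq0.le, sub_add_cancel]
  rw [h2]
  refine (mul_le_mul_of_nonneg_left h1 (by positivity)).trans ?_
  rw [mul_left_comm]
  refine mul_le_mul_of_nonneg_left ?_ (by positivity)
  rw [Finset.mul_sum]
  refine Finset.sum_le_sum fun i _ => ?_
  have h3 := rpow_mul_rpow_mul_rpow_le hx (ha i) (hb i) (sub_nonneg.2 hqs) hq0.le
  rwa [show s - q + (q + q) = s + q by ring] at h3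

end Interpolation

/-! ### Decay of the fractional moments -/

section Decay

variable {d : ℕ}

theorem card_cycleLabels_le (π : Equiv.Perm (Dir d)) (τ : Dir d) (x : Site d) :
    (cycleLabels π τ x).card ≤ ∑ σ, Function.minimalPeriod π σ := by
  refine Finset.card_image_le.trans ?_
  rw [Finset.card_range]
  exact Finset.single_le_sum (f := fun σ => Function.minimalPeriod π σ) (fun _ _ => Nat.zero_le _)
    (Finset.mem_univ τ)

theorem exists_lintegral_green_rpow_le {μ : Measure Torus} [IsProbabilityMeasure μ]
    (hμ : HasBoundedDensity μ) {π : Equiv.Perm (Dir d)} (hπ : NoDrift π) {s q : ℝ}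
    (hq0 : 0 < q) (hqs : q ≤ s) (hsq : s + q < 1) :
    ∃ c : NNReal, ∀ (L : ℕ) (C : Coin d) (z : ℂ), ‖z‖ ≠ 1 → ∀ (τ σ : Dir d) (x y : Site d),
      ket σ y ∈ boxSpace π L → 2 < boxNorm (x - y) →
      ∫⁻ ω, ENNReal.ofReal (‖green (boxCoins π C L) z (τ, x) (σ, y) ω‖ ^ s) ∂(phaseLaw d μ) ≤
        ENNReal.ofReal (opNorm ((C : Matrix (Dir d) (Dir d) ℂ) -
          (permCoin π : Matrix (Dir d) (Dir d) ℂ)) ^ q) * c := by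
  obtain ⟨K, hK⟩ := exists_lintegral_green_le (d := d) hμ (t := s + q) (by linarith) hsq
  -- Number of terms in the resolvent identity, bounded independently of `L`, times one a priori
  -- bound for each of the three Green functions.
  refine ⟨((∑ σ, Function.minimalPeriod π σ : ℕ) * Fintype.card (Dir d) : ℕ) * (K + K + K),
    fun L C z hz τ σ x y hy hxy => ?_⟩
  set O := cycleLabels π τ (x - r τ) ×ˢ (Finset.univ : Finset (Dir d)) with hO
  set η := opNorm ((C : Matrix (Dir d) (Dir d) ℂ) - (permCoin π : Matrix (Dir d) (Dir d) ℂ))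
  set X := green (boxCoins π C L) z (τ, x) (σ, y)
  set A : (Dir d × Site d) × Dir d → Phases d → ℂ := fun k =>
    green (fun _ => permCoin π) z (τ, x) k.1
  set B : (Dir d × Site d) × Dir d → Phases d → ℂ := fun k =>
    green (boxCoins π C L) z (k.2, k.1.2 - r k.1.1) (σ, y)
  have hη : 0 ≤ η := opNorm_nonneg _
  have hmeas : ∀ {Y : Phases d → ℂ}, Measurable Y →
      Measurable fun ω => ENNReal.ofReal (‖Y ω‖ ^ (s + q)) := fun hY =>
    ENNReal.measurable_ofReal.comp (hY.norm.pow_const _)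
  have hpt : ∀ ω, ENNReal.ofReal (‖X ω‖ ^ s) ≤ ENNReal.ofReal (η ^ q) * ∑ k ∈ O,
      (ENNReal.ofReal (‖X ω‖ ^ (s + q)) + ENNReal.ofReal (‖A k ω‖ ^ (s + q)) +
        ENNReal.ofReal (‖B k ω‖ ^ (s + q))) := by
    intro ω
    have h := rpow_le_of_le_mul_sum O (fun k => norm_nonneg (A k ω)) (fun k => norm_nonneg (B k ω))
      (norm_nonneg (X ω)) hη hq0 (by linarith) hqs (norm_green_le_sum hπ C L ω hz hy hxy)
    refine (ENNReal.ofReal_le_ofReal h).trans (le_of_eq ?_)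
    rw [ENNReal.ofReal_mul (by positivity), ENNReal.ofReal_sum_of_nonneg fun k _ => by positivity]
    congr 1
    refine Finset.sum_congr rfl fun k _ => ?_
    rw [ENNReal.ofReal_add (by positivity) (by positivity),
      ENNReal.ofReal_add (by positivity) (by positivity)]
  refine (lintegral_mono hpt).trans ?_
  rw [lintegral_const_mul' _ _ ENNReal.ofReal_ne_top]
  gcongr
  have hXm := hmeas (measurable_green (boxCoins π C L) hz (τ, x) (σ, y))
  have hAm : ∀ k, Measurable fun ω => ENNReal.ofReal (‖A k ω‖ ^ (s + q)) := fun k =>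
    hmeas (measurable_green _ hz _ _)
  have hBm : ∀ k, Measurable fun ω => ENNReal.ofReal (‖B k ω‖ ^ (s + q)) := fun k =>
    hmeas (measurable_green _ hz _ _)
  have hsum : ∀ k ∈ O, Measurable fun ω => ENNReal.ofReal (‖X ω‖ ^ (s + q)) +
      ENNReal.ofReal (‖A k ω‖ ^ (s + q)) + ENNReal.ofReal (‖B k ω‖ ^ (s + q)) := fun k _ =>
    (hXm.add (hAm k)).add (hBm k)
  rw [lintegral_finsetSum _ hsum]
  have hterm : ∀ k ∈ O, ∫⁻ ω, (ENNReal.ofReal (‖X ω‖ ^ (s + q)) +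
      ENNReal.ofReal (‖A k ω‖ ^ (s + q)) + ENNReal.ofReal (‖B k ω‖ ^ (s + q))) ∂(phaseLaw d μ) ≤
      ((K + K + K : NNReal) : ENNReal) := by
    intro k _
    rw [lintegral_add_right _ (hBm k), lintegral_add_right _ (hAm k)]
    push_cast
    exact add_le_add (add_le_add (hK _ _ hz _ _) (hK _ _ hz _ _)) (hK _ _ hz _ _)
  refine (Finset.sum_le_card_nsmul _ _ _ hterm).trans ?_
  rw [nsmul_eq_mul, ENNReal.coe_mul, ENNReal.coe_natCast]
  gcongr
  rw [hO, Finset.card_product, Finset.card_univ]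
  exact Nat.mul_le_mul_right _ (card_cycleLabels_le π τ _)

end Decay

end

end RandomQuantumWalk

/-! ### Choice of the exponent and conclusion -/

open RandomQuantumWalk
theorem mainTheorem4 (d : ℕ) (hd : 1 ≤ d)
    (μ : MeasureTheory.Measure Torus) [MeasureTheory.IsProbabilityMeasure μ]
    (hμ : HasBoundedDensity μ)
    (π : Equiv.Perm (Dir d)) (hπ : NoDrift π)
    (s a p : ℝ) (hs0 : 0 < s) (hs1 : s < 1) (ha : 0 ≤ a) (hp : 1 / (1 - s) < p) :
    ∃ c : ℝ, 0 < c ∧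
      ∀ L : ℕ, 1 ≤ L →
      ∀ C : Coin d,
        opNorm ((C : Matrix (Dir d) (Dir d) ℂ) - (permCoin π : Matrix (Dir d) (Dir d) ℂ)) ≤
            1 / (L : ℝ) ^ (2 * (a * p + (d : ℝ)) + a / s) →
      ∀ z : ℂ, ‖z‖ ≠ 1 →
        (∀ ω : Phases d,
          IsUnit (boxWalk hπ C L ω - z • (1 : Module.End ℂ (boxSpace π L)))) ∧
        ∀ (τ σ : Dir d) (x y : Site d)
          (hx : ket τ x ∈ boxSpace π L) (hy : ket σ y ∈ boxSpace π L),
          2 < boxNorm (x - y) →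
          MeasureTheory.Integrable
            (fun ω => ‖resolventElement hπ C L ω z ⟨ket τ x, hx⟩ ⟨ket σ y, hy⟩‖ ^ s)
            (phaseLaw d μ) ∧
          ∫ ω, ‖resolventElement hπ C L ω z ⟨ket τ x, hx⟩ ⟨ket σ y, hy⟩‖ ^ s ∂(phaseLaw d μ)
            ≤ c / (L : ℝ) ^ a := by
  -- The interpolation needs `q ≤ s` and `s + q < 1`.
  set q : ℝ := min s ((1 - s) / 2) with hq
  have hq0 : 0 < q := lt_min hs0 (by linarith)
  have hqs : q ≤ s := min_le_left _ _
  have hsq : s + q < 1 := by linarith [min_le_right s ((1 - s) / 2)]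
  obtain ⟨c, hc⟩ := exists_lintegral_green_rpow_le hμ hπ hq0 hqs hsq
  -- The `+ 1` only ensures positivity, since `c` may be zero.
  refine ⟨c + 1, by positivity, fun L hL C hC z hz =>
    ⟨fun ω => isUnit_boxWalk_sub_smul hπ C L ω hz, fun τ σ x y hx hy hxy => ?_⟩⟩
  have hL1 : (1 : ℝ) ≤ L := by exact_mod_cast hL
  have hp0 : 1 < p * (1 - s) := (div_lt_iff₀ (by linarith)).1 hp
  have hpp : 0 < p := lt_trans (by
    have : 0 < 1 - s := by linarith
    positivity) hp
  -- If `q = s`, the term `a / s` alone yields `a`; if `q = (1 - s) / 2`, the term `2 a p` yields `a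
  -- p (1 - s) ≥ a`.
  have hexp : a ≤ (2 * (a * p + (d : ℝ)) + a / s) * q := by
    have hd0 : (0 : ℝ) ≤ d := Nat.cast_nonneg d
    have has : 0 ≤ a / s := by positivity
    rcases min_choice s ((1 - s) / 2) with h | h
    · rw [hq, h, add_mul, div_mul_cancel₀ _ hs0.ne']
      have : 0 ≤ 2 * (a * p + (d : ℝ)) * s := by positivity
      linarith
    · rw [hq, h]
      have h1 : 0 ≤ a * (p * (1 - s) - 1) := mul_nonneg ha (by linarith)
      have h2 : 0 ≤ (2 * (d : ℝ) + a / s) * ((1 - s) / 2) :=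
        mul_nonneg (by positivity) (by linarith)
      nlinarith
  have hη : opNorm ((C : Matrix (Dir d) (Dir d) ℂ) -
      (permCoin π : Matrix (Dir d) (Dir d) ℂ)) ^ q ≤ 1 / (L : ℝ) ^ a := by
    refine (Real.rpow_le_rpow (opNorm_nonneg _) hC hq0.le).trans ?_
    rw [Real.div_rpow zero_le_one (by positivity), Real.one_rpow, ← Real.rpow_mul (by positivity)]
    exact one_div_le_one_div_of_le (by positivity)
      (Real.rpow_le_rpow_of_exponent_le hL1 hexp)
  simp_rw [resolventElement_eq_green hπ C L _ hz hx hy]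
  have hmeas : Measurable fun ω => ‖green (boxCoins π C L) z (τ, x) (σ, y) ω‖ ^ s :=
    (measurable_green _ hz _ _).norm.pow_const _
  have hbound : ∫⁻ ω, ENNReal.ofReal (‖green (boxCoins π C L) z (τ, x) (σ, y) ω‖ ^ s)
      ∂(phaseLaw d μ) ≤ ENNReal.ofReal (c / (L : ℝ) ^ a) := by
    refine (hc L C z hz τ σ x y hy hxy).trans ?_
    rw [← ENNReal.ofReal_coe_nnreal, ← ENNReal.ofReal_mul
      (Real.rpow_nonneg (opNorm_nonneg _) _), div_eq_inv_mul, ← one_div]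
    exact ENNReal.ofReal_le_ofReal (mul_le_mul_of_nonneg_right hη c.2)
  have hnonneg : ∀ ω, 0 ≤ ‖green (boxCoins π C L) z (τ, x) (σ, y) ω‖ ^ s := fun ω => by
    positivity
  refine ⟨⟨hmeas.aestronglyMeasurable, ?_⟩, ?_⟩
  · rw [MeasureTheory.hasFiniteIntegral_iff_ofReal (Filter.Eventually.of_forall hnonneg)]
    exact hbound.trans_lt ENNReal.ofReal_lt_top
  · rw [MeasureTheory.integral_eq_lintegral_of_nonneg_ae (Filter.Eventually.of_forall hnonneg)
      hmeas.aestronglyMeasurable]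
    refine (ENNReal.toReal_le_of_le_ofReal (by positivity) hbound).trans ?_
    gcongr
    linarith
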